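/- Let $H$ be a real Hilbert space and let $A : D(A)\subseteq H \to H$ be a linear m-accretive operator, i.e. $\langle Ax,x\rangle \ge 0$ for all $x\in D(A)$ and the range of $I+A$ is $H$. Let $(S(t))_{t\ge 0}$ be the contraction semigroup generated by $-A$. Let $K>\tfrac12$, let $n\ge 1$ be a real number, and put $\psi(t)=1+t$. For $t_0\ge 0$, $X_0\in \overline{D(A)}=H$ and $d\in L^\infty(\mathbb R_+;H)$, consider the closed loop $$\dot X(t)+AX(t) = -K\psi(t)^n X(t)+d(t)\quad (t\ge t_0),\qquad X(t_0)=X_0,$$ in the mild sense: $X\in C([t_0,\infty);H)$ and $X(t)=S(t-t_0)X_0+\int_{t_0}^t S(t-s)\bigl(-K\psi(s)^nX(s)+d(s)\bigr)\,ds$ for all $t\ge t_0$. Write $\|d\|_\infty=\operatorname{ess\,sup}_{t\ge 0}\|d(t)\|$. Then: 1. For all such $t_0,X_0,d$ the closed loop has exactly one mild solution on $[t_0,\infty)$. 2. The closed loop is uniformly input-to-state stable: there are $\beta\in\mathcal{KL}$ and $\gamma\in\mathcal K_\infty$ such that for all $t\ge t_0\ge 0$, $X_0$ and $d$, $$\|X(t)\|\le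 \beta(\|X_0\|,t-t_0)+\gamma(\|d\|_\infty).$$ 3. The closed loop is uniformly hyperexponentially stable: there are $\kappa_0\ge 0$, $\rho,\kappa\in\mathcal K_\infty$ and $\beta\in\mathcal{KL}$ such that for all $t\ge t_0\ge 0$, $X_0$ and $d$, $$\|X(t)\|\le e^{-(\kappa(t-t_0)+\kappa_0)(t-t_0)}\rho(\|X_0\|)+\beta(\|d\|_\infty,t-t_0).$$ 4. Explicitly, with $\eta=2K-1$ and initial time $t_0=0$, for all $X_0$, $d$ and all $t\ge 0$, $$\|X(t)\|^2\le e^{-\eta t(t+2)/2}\|X_0\|^2+\frac4\eta\, r_{2/\eta,1}\,\frac{\|d\|_\infty^2}{\psi(t)^2},$$ where, for $a,\alpha>0$ and $b=\frac{a\alpha-1}{a}$, $$r_{a,\alpha}=(a\alpha)^\alpha\int_0^{\max(0,b)} \frac{e^{s-b}}{(as+1)^\alpha}\,ds+(a\alpha+1)+\Bigl(\frac{a\alpha+1}{a\alpha}\Bigr)^\alpha\bigl(1-e^{-1/a}\bigr).$$ Here $\mathcal K$ is the class of continuous strictly increasing $\alpha:\mathbb R_+\to\mathbb R_+$ with $\alpha(0)=0$;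 $\mathcal K_\infty$ is the class of unbounded functions in $\mathcal K$; and $\mathcal{KL}$ is the class of continuous $\beta:\mathbb R_+^2\to\mathbb R_+$ such that $\beta(\cdot,t)\in\mathcal K$ for every $t\ge 0$ and $\beta(s,\cdot)$ decreases strictly to $0$ for every $s>0$. -/

import Mathlib

open Filter Topology Set MeasureTheory
open scoped ENNReal

noncomputable section

/-- A linear operator `A`, with domain `A.domain`, on a real Hilbert space is m-accretive
(equivalently, maximal monotone): it is monotone and the range of `I + A` is everything. -/
def IsMAccretive {H : Type*} [NormedAddCommGroup H] [InnerProductSpace ℝ H]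
    (A : H →ₗ.[ℝ] H) : Prop :=
  (∀ x : A.domain, 0 ≤ inner ℝ (A x) (x : H)) ∧
    ∀ y : H, ∃ x : A.domain, (x : H) + A x = y

/-- `S`, restricted to times `t ≥ 0`, is a strongly continuous semigroup of linear contractions.
The values at negative times are irrelevant. -/
structure IsContractionSemigroup {H : Type*} [NormedAddCommGroup H] [InnerProductSpace ℝ H]
    (S : ℝ → H →L[ℝ] H) : Prop where
  map_zero : S 0 = ContinuousLinearMap.id ℝ H
  map_add : ∀ s t : ℝ, 0 ≤ s → 0 ≤ t → S (s + t) = (S s).comp (S t)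
  strongly_continuous : ∀ x : H, ContinuousOn (fun t => S t x) (Ici 0)
  contraction : ∀ t : ℝ, 0 ≤ t → ∀ x : H, ‖S t x‖ ≤ ‖x‖

/-- The infinitesimal generator of `S` is `-A` (equality of operators, including domains). -/
def HasGeneratorNeg {H : Type*} [NormedAddCommGroup H] [InnerProductSpace ℝ H]
    (A : H →ₗ.[ℝ] H) (S : ℝ → H →L[ℝ] H) : Prop :=
  ∀ x y : H, (x, y) ∈ A.graph ↔
    Tendsto (fun h : ℝ => h⁻¹ • (S h x - x)) (𝓝[>] 0) (𝓝 (-y))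

/-- `X` is a mild solution on `[t₀, ∞)` of `X' + A X = f(t) X + d`, `X(t₀) = x₀`: it is continuous
and satisfies the Duhamel formula for the contraction semigroup generated by `-A`. -/
def IsMildSolution {H : Type*} [NormedAddCommGroup H] [InnerProductSpace ℝ H]
    (A : H →ₗ.[ℝ] H) (f : ℝ → ℝ) (d : ℝ → H) (t₀ : ℝ) (x₀ : H) (X : ℝ → H) : Prop :=
  ∃ S : ℝ → H →L[ℝ] H, IsContractionSemigroup S ∧ HasGeneratorNeg A S ∧
    ContinuousOn X (Ici t₀) ∧
    ∀ t, t₀ ≤ t → X t = S (t - t₀) x₀ + ∫ s in t₀..t, S (t - s) (f s • X s + d s)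

/-- The disturbances: (classes of) strongly measurable, essentially bounded functions on
`[0, ∞)`. -/
def IsDisturbance {H : Type*} [NormedAddCommGroup H] (d : ℝ → H) : Prop :=
  MemLp d ∞ (volume.restrict (Ici (0 : ℝ)))

/-- The essential supremum of `‖d(t)‖` over `t ≥ 0`. -/
def supNorm {H : Type*} [NormedAddCommGroup H] (d : ℝ → H) : ℝ :=
  (eLpNorm d ∞ (volume.restrict (Ici (0 : ℝ)))).toReal

/-- Comparison functions of class `𝒦` on `[0, ∞)`. -/
def IsClassK (α : ℝ → ℝ) : Prop :=
  ContinuousOn α (Ici 0) ∧ StrictMonoOn α (Ici 0) ∧ α 0 = 0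

/-- Comparison functions of class `𝒦_∞` on `[0, ∞)`. -/
def IsClassKInf (α : ℝ → ℝ) : Prop :=
  IsClassK α ∧ Tendsto α atTop atTop

/-- Comparison functions of class `𝒦ℒ` on `[0, ∞) × [0, ∞)`. -/
def IsClassKL (β : ℝ → ℝ → ℝ) : Prop :=
  ContinuousOn (fun p : ℝ × ℝ => β p.1 p.2) (Ici 0 ×ˢ Ici 0) ∧
    (∀ t, 0 ≤ t → IsClassK fun s => β s t) ∧
    ∀ s, 0 < s → StrictAntiOn (β s) (Ici 0) ∧ Tendsto (β s) atTop (𝓝 0)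

/-- For every initial time, initial state and disturbance, `X' + A X = f(t) X + d` has exactly one
mild solution on `[t₀, ∞)`. -/
def IsWellPosed {H : Type*} [NormedAddCommGroup H] [InnerProductSpace ℝ H]
    (A : H →ₗ.[ℝ] H) (f : ℝ → ℝ) : Prop :=
  ∀ (t₀ : ℝ) (x₀ : H) (d : ℝ → H), 0 ≤ t₀ → IsDisturbance d →
    ∃ X : ℝ → H, IsMildSolution A f d t₀ x₀ X ∧
      ∀ Y : ℝ → H, IsMildSolution A f d t₀ x₀ Y → EqOn Y X (Ici t₀)

/-- Input-to-state stability of `X' + A X = f(t) X + d`, uniformly in the initial time. -/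
def IsUniformlyISS {H : Type*} [NormedAddCommGroup H] [InnerProductSpace ℝ H]
    (A : H →ₗ.[ℝ] H) (f : ℝ → ℝ) : Prop :=
  ∃ (β : ℝ → ℝ → ℝ) (γ : ℝ → ℝ), IsClassKL β ∧ IsClassKInf γ ∧
    ∀ (t₀ : ℝ) (x₀ : H) (d X : ℝ → H), 0 ≤ t₀ → IsDisturbance d →
      IsMildSolution A f d t₀ x₀ X →
      ∀ t, t₀ ≤ t → ‖X t‖ ≤ β ‖x₀‖ (t - t₀) + γ (supNorm d)

/-- Uniform hyperexponential stability of `X' + A X = f(t) X + d`. -/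
def IsUniformlyHyperexponentiallyStable {H : Type*} [NormedAddCommGroup H]
    [InnerProductSpace ℝ H] (A : H →ₗ.[ℝ] H) (f : ℝ → ℝ) : Prop :=
  ∃ (κ₀ : ℝ) (ρ κ : ℝ → ℝ) (β : ℝ → ℝ → ℝ),
    0 ≤ κ₀ ∧ IsClassKInf ρ ∧ IsClassKInf κ ∧ IsClassKL β ∧
    ∀ (t₀ : ℝ) (x₀ : H) (d X : ℝ → H), 0 ≤ t₀ → IsDisturbance d →
      IsMildSolution A f d t₀ x₀ X →
      ∀ t, t₀ ≤ t →
        ‖X t‖ ≤ Real.exp (-(κ (t - t₀) + κ₀) * (t - t₀)) * ρ ‖x₀‖ + β (supNorm d) (t - t₀)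

/-- The constant `r_{a,α}`. The upper limit of the integral is `(aα - 1)/a` for `aα ≥ 1`; for
`aα < 1` the integral term is absent. -/
def rConst (a α : ℝ) : ℝ :=
  (a * α) ^ α *
      (∫ s in (0 : ℝ)..max 0 ((a * α - 1) / a),
        Real.exp (s - (a * α - 1) / a) / (a * s + 1) ^ α) +
    (a * α + 1) +
    ((a * α + 1) / (a * α)) ^ α * (1 - Real.exp (-(1 / a)))

/-- The time function `ψ(t) = 1 + t`. -/
def psi (t : ℝ) : ℝ := 1 + t

/-- The gain `-K ψ(t)^n` of the feedback `u(t) = -K ψ(t)^n X(t)`. -/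
def feedbackGain (K n : ℝ) (t : ℝ) : ℝ := -K * psi t ^ n

end

/-! The closed loop is linear with a scalar time-dependent gain, so an integrating factor removes
the feedback. If `F` is a primitive of the gain `f`, then `exp (F t₀ - F t) • X t` is a mild
solution of the problem without feedback and with a rescaled disturbance, which Duhamel's formula
solves explicitly. Since a mild solution need not be differentiable, this change of unknown is made
inside the integral equation, by Fubini (`IsContractionSemigroup.duhamel_smul`). It yields
uniqueness, existence (by reversing the change), and the bound `IsMildSolution.norm_le`, in which
`A` enters only through the contractivity of its semigroup.

A mild solution carries an unspecified semigroup, so existence and uniqueness of the semigroup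
generated by `-A` are both needed. Existence is the Hille–Yosida construction: the exponentials of
the Yosida approximations converge strongly. Uniqueness follows by differentiating `S (t - s) (T s
x)` in `s`.

The stability claims are then scalar. Write Φ(s) = s(s+2)/2, a primitive of ψ. As ψ ≥ 1 and n ≥ 1,
F(t) - F(s) ≤ -K(Φ(t) - Φ(s)), and Φ(t) - Φ(s) = (t-s)(t+s+2)/2. Bounding the second factor below by
a constant gives ISS; bounding it by a multiple of t - t₀ + 1 gives hyperexponential decay. The
explicit estimate squares the bound with a ψ-weighted Young inequality
(`sq_exp_mul_add_mul_integral_le`) and integrates (`integral_exp_div_psi_mul_sq_le`). -/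

/-! ### Exponentials of bounded accretive operators -/

section BoundedExp

variable {H : Type*} [NormedAddCommGroup H] [InnerProductSpace ℝ H]

/-- The semigroup generated by the bounded operator `-B`. -/
noncomputable def expNeg (B : H →L[ℝ] H) (t : ℝ) : H →L[ℝ] H := NormedSpace.exp (t • (-B))

theorem expNeg_zero (B : H →L[ℝ] H) : expNeg B 0 = 1 := by
  simp [expNeg]

theorem zero_expNeg (t : ℝ) : expNeg (0 : H →L[ℝ] H) t = 1 := by
  simp [expNeg]

theorem Commute.expNeg_right {B C : H →L[ℝ] H} (h : Commute C B) (t : ℝ) :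
    Commute C (expNeg B t) :=
  Commute.exp_right (h.neg_right.smul_right t)

variable [CompleteSpace H]

theorem expNeg_add (B : H →L[ℝ] H) (s t : ℝ) : expNeg B (s + t) = expNeg B s * expNeg B t := by
  let _ : NormedAlgebra ℚ (H →L[ℝ] H) := NormedAlgebra.restrictScalars ℚ ℝ _
  rw [expNeg, add_smul, NormedSpace.exp_add_of_commute]
  · rfl
  · exact ((Commute.refl (-B)).smul_left s).smul_right t

theorem hasDerivAt_expNeg (B : H →L[ℝ] H) (t : ℝ) :
    HasDerivAt (expNeg B) (expNeg B t * (-B)) t :=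
  hasDerivAt_exp_smul_const (-B) t

theorem hasDerivAt_expNeg_apply (B : H →L[ℝ] H) (x : H) (t : ℝ) :
    HasDerivAt (fun s => expNeg B s x) (-(expNeg B t (B x))) t := by
  have := (hasDerivAt_expNeg B t).clm_apply (hasDerivAt_const t x)
  simpa using this

/-- The squared norm along an orbit has derivative -2⟨Bu, u⟩ ≤ 0. -/
theorem norm_expNeg_apply_le {B : H →L[ℝ] H} (hB : ∀ x, 0 ≤ inner ℝ (B x) x) {t : ℝ}
    (ht : 0 ≤ t) (x : H) : ‖expNeg B t x‖ ≤ ‖x‖ := by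
  have hd : ∀ s, HasDerivAt (fun s => ‖expNeg B s x‖ ^ 2)
      (2 * inner ℝ (expNeg B s x) (-(expNeg B s (B x)))) s := fun s =>
    (hasDerivAt_expNeg_apply B x s).norm_sq
  have hanti : Antitone fun s => ‖expNeg B s x‖ ^ 2 := by
    refine antitone_of_deriv_nonpos (fun s => (hd s).differentiableAt) fun s => ?_
    rw [(hd s).deriv]
    have hc : expNeg B s (B x) = B (expNeg B s x) := by
      have := ((Commute.refl B).expNeg_right s).eq
      exact (DFunLike.congr_fun this x).symm
    rw [hc, inner_neg_right, real_inner_comm]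
    nlinarith [hB (expNeg B s x)]
  have := hanti ht
  simp only [expNeg_zero, one_apply_eq_self] at this
  exact (sq_le_sq₀ (norm_nonneg _) (norm_nonneg x)).1 this

/-- The path s ↦ e^{-(t-s)C} e^{-sB} x joins the two vectors; by commutation its velocity is a
product of contractions applied to Cx - Bx. -/
theorem norm_expNeg_sub_expNeg_le {B C : H →L[ℝ] H} (hB : ∀ x, 0 ≤ inner ℝ (B x) x)
    (hC : ∀ x, 0 ≤ inner ℝ (C x) x) (h : Commute B C) {t : ℝ} (ht : 0 ≤ t) (x : H) :
    ‖expNeg B t x - expNeg C t x‖ ≤ t * ‖B x - C x‖ := by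
  have hd : ∀ s, HasDerivAt (fun s => expNeg C (t - s) (expNeg B s x))
      (expNeg C (t - s) (expNeg B s (C x - B x))) s := fun s => by
    have h1 : HasDerivAt (fun s => expNeg C (t - s)) (-(expNeg C (t - s) * (-C))) s := by
      have := (hasDerivAt_expNeg C (t - s)).scomp s ((hasDerivAt_id s).const_sub t)
      simpa [Function.comp_def] using this
    have h2 := h1.clm_apply (hasDerivAt_expNeg_apply B x s)
    convert h2 using 1
    have hc : C (expNeg B s x) = expNeg B s (C x) :=
      DFunLike.congr_fun (h.symm.expNeg_right s).eq x
    simp [hc, sub_eq_add_neg]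
  have := norm_image_sub_le_of_norm_deriv_le_segment' (a := 0) (b := t) (C := ‖B x - C x‖)
    (fun s _ => (hd s).hasDerivWithinAt) (fun s hs => ?_) t ⟨ht, le_rfl⟩
  · simpa [expNeg_zero, mul_comm] using this
  · rw [norm_sub_rev]
    exact (norm_expNeg_apply_le hC (by linarith [hs.2]) _).trans
      (norm_expNeg_apply_le hB hs.1 _)

theorem norm_expNeg_sub_self_le {B : H →L[ℝ] H} (hB : ∀ x, 0 ≤ inner ℝ (B x) x) {t : ℝ}
    (ht : 0 ≤ t) (x : H) : ‖expNeg B t x - x‖ ≤ t * ‖B x‖ := by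
  simpa [zero_expNeg] using
    norm_expNeg_sub_expNeg_le (C := 0) hB (by simp) (Commute.zero_right B) ht x

/-- This bound, uniform along the Yosida approximations, survives their limit and identifies the
generator. The sharp factor 1/2 is not needed. -/
theorem norm_expNeg_sub_taylor_le {B : H →L[ℝ] H} (hB : ∀ x, 0 ≤ inner ℝ (B x) x) {t : ℝ}
    (ht : 0 ≤ t) (x : H) : ‖expNeg B t x - x + t • B x‖ ≤ t ^ 2 * ‖B (B x)‖ := by
  have hd : ∀ s, HasDerivAt (fun s => expNeg B s x + s • B x)
      (-(expNeg B s (B x)) + B x) s := fun s => by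
    simpa using (hasDerivAt_expNeg_apply B x s).fun_add ((hasDerivAt_id s).smul_const (B x))
  have := norm_image_sub_le_of_norm_deriv_le_segment' (a := 0) (b := t) (C := t * ‖B (B x)‖)
    (fun s _ => (hd s).hasDerivWithinAt) (fun s hs => ?_) t ⟨ht, le_rfl⟩
  · simp only [expNeg_zero, one_apply_eq_self, zero_smul, add_zero, sub_zero] at this
    calc _ = ‖expNeg B t x + t • B x - x‖ := by congr 1; abel
      _ ≤ _ := this
      _ = _ := by ring
  · rw [neg_add_eq_sub, norm_sub_rev]
    exact (norm_expNeg_sub_self_le hB hs.1 _).trans (by gcongr; exact hs.2.le)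

end BoundedExp

/-! ### Yosida approximation -/

section Yosida

variable {H : Type*} [NormedAddCommGroup H] [InnerProductSpace ℝ H]

/-- The resolvent `(I + A)⁻¹` of an m-accretive operator. -/
theorem IsMAccretive.exists_resolvent {A : H →ₗ.[ℝ] H} (hA : IsMAccretive A) :
    ∃ J : H →L[ℝ] H, (∀ y, 0 ≤ inner ℝ (y - J y) (J y)) ∧ (∀ y, J y = 0 → y = 0) ∧
      ∀ x z : H, (x, z) ∈ A.graph ↔ J (x + z) = x := by
  obtain ⟨hacc, hsurj⟩ := hA
  have hgraph : ∀ x z : H, (x, z) ∈ A.graph → 0 ≤ inner ℝ z x := by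
    intro x z hxz
    obtain ⟨u, hu, hu'⟩ := A.mem_graph_iff.1 hxz
    simp only at hu hu'
    rw [← hu, ← hu']
    exact hacc u
  have hsurj' : ∀ y : H, ∃ x : H, (x, y - x) ∈ A.graph := fun y => by
    obtain ⟨u, hu⟩ := hsurj y
    refine ⟨u, ?_⟩
    rw [← hu, add_sub_cancel_left]
    exact A.mem_graph u
  choose f hf using hsurj'
  -- The difference of two graph points with the same sum has the form (δ, -δ), and monotonicity
  -- forces δ = 0. Linearity of the resolvent follows from this uniqueness.
  have huniq : ∀ x z : H, (x, z) ∈ A.graph → f (x + z) = x := fun x z hxz => by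
    have h1 := A.graph.sub_mem (hf (x + z)) hxz
    have h2 := hgraph _ _ h1
    have h3 : x + z - f (x + z) - z = -(f (x + z) - x) := by abel
    rw [h3, inner_neg_left, real_inner_self_eq_norm_sq] at h2
    have : ‖f (x + z) - x‖ = 0 := by nlinarith [norm_nonneg (f (x + z) - x)]
    exact sub_eq_zero.1 (norm_eq_zero.1 this)
  have hmono : ∀ y, 0 ≤ inner ℝ (y - f y) (f y) := fun y => hgraph _ _ (hf y)
  let J₀ : H →ₗ[ℝ] H :=
    { toFun := f
      map_add' := fun y z => by
        have := huniq _ _ (A.graph.add_mem (hf y) (hf z))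
        rwa [show f y + f z + (y - f y + (z - f z)) = y + z by abel] at this
      map_smul' := fun c y => by
        have := huniq _ _ (A.graph.smul_mem c (hf y))
        rwa [← smul_add, add_sub_cancel] at this }
  refine ⟨J₀.mkContinuous 1 fun y => ?_, hmono, fun y hy => ?_, fun x z => ⟨huniq x z, fun h => ?_⟩⟩
  · rw [one_mul]
    change ‖f y‖ ≤ ‖y‖
    have h1 := hmono y
    rw [inner_sub_left, real_inner_self_eq_norm_sq] at h1
    have h2 := real_inner_le_norm y (f y)
    by_contra! h3
    nlinarith [norm_nonneg y, norm_nonneg (f y)]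
  · have h1 := hf y
    change f y = 0 at hy
    rw [hy, sub_zero] at h1
    exact A.graph_fst_eq_zero_snd h1 rfl
  · have h1 := hf (x + z)
    change f (x + z) = x at h
    rwa [h, add_sub_cancel_left] at h1

variable {J : H →L[ℝ] H}

/-- With A = J⁻¹ - I and x = lz + (1-l)Jz one has Jz = (I + lA)⁻¹x, so this is the contractivity of
the rescaled resolvent. -/
theorem norm_le_norm_smul_add_smul_resolvent (hJ : ∀ y, 0 ≤ inner ℝ (y - J y) (J y)) {l : ℝ}
    (hl : 0 ≤ l) (z : H) : ‖J z‖ ≤ ‖l • z + (1 - l) • J z‖ := by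
  have h1 : l • z + (1 - l) • J z = l • (z - J z) + J z := by module
  have h2 := real_inner_le_norm (l • z + (1 - l) • J z) (J z)
  have h3 : inner ℝ (l • z + (1 - l) • J z) (J z) = l * inner ℝ (z - J z) (J z) + ‖J z‖ ^ 2 := by
    rw [h1, inner_add_left, inner_smul_left, real_inner_self_eq_norm_sq]; simp
  by_contra! h4
  nlinarith [norm_nonneg (l • z + (1 - l) • J z), norm_nonneg (J z), mul_nonneg hl (hJ z)]

theorem inner_sub_resolvent_self_nonneg (hJ : ∀ y, 0 ≤ inner ℝ (y - J y) (J y)) (y : H) :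
    0 ≤ inner ℝ (y - J y) y := by
  have h : inner ℝ (y - J y) y = inner ℝ (y - J y) (J y) + ‖y - J y‖ ^ 2 := by
    rw [← real_inner_self_eq_norm_sq, ← inner_add_right, add_sub_cancel]
  rw [h]
  exact add_nonneg (hJ y) (sq_nonneg _)

variable [CompleteSpace H]

/-- If v is orthogonal to the range, then ⟨Jv, v⟩ = 0, so monotonicity gives Jv = 0, and v = 0 by
injectivity. -/
theorem denseRange_resolvent (hJ : ∀ y, 0 ≤ inner ℝ (y - J y) (J y))
    (hinj : ∀ y, J y = 0 → y = 0) : DenseRange J := by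
  have h : J.range.topologicalClosure = ⊤ := by
    rw [Submodule.topologicalClosure_eq_top_iff, Submodule.eq_bot_iff]
    intro v hv
    have h1 : inner ℝ (J v) v = 0 := (Submodule.mem_orthogonal _ v).1 hv _ ⟨v, rfl⟩
    have h2 := hJ v
    rw [inner_sub_left, real_inner_comm, h1, real_inner_self_eq_norm_sq] at h2
    refine hinj v (norm_eq_zero.1 ?_)
    nlinarith [norm_nonneg (J v)]
  rw [DenseRange, dense_iff_closure_eq]
  exact congrArg (fun s : Submodule ℝ H => (s : Set H)) h

/-- Lax–Milgram: monotonicity makes ⟨Ju, u⟩ nonnegative, so the operator is coercive with constant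
l. -/
theorem exists_inverse_smul_add_smul_resolvent (hJ : ∀ y, 0 ≤ inner ℝ (y - J y) (J y)) {l : ℝ}
    (hl : 0 < l) (hl1 : l ≤ 1) :
    ∃ R : H →L[ℝ] H, (l • (1 : H →L[ℝ] H) + (1 - l) • J) * R = 1 ∧
      R * (l • (1 : H →L[ℝ] H) + (1 - l) • J) = 1 := by
  set M := l • (1 : H →L[ℝ] H) + (1 - l) • J with hM
  have hcoer : IsCoercive ((innerSL ℝ).comp M) := by
    refine ⟨l, hl, fun u => ?_⟩
    have h1 : inner ℝ (J u) u = inner ℝ (u - J u) (J u) + ‖J u‖ ^ 2 := by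
      rw [← real_inner_self_eq_norm_sq, ← inner_add_left, sub_add_cancel, real_inner_comm]
    have h2 : inner ℝ (M u) u = l * ‖u‖ ^ 2 + (1 - l) * inner ℝ (J u) u := by
      simp [hM, inner_add_left, inner_smul_left]
    change l * ‖u‖ * ‖u‖ ≤ inner ℝ (M u) u
    rw [h2, h1]
    nlinarith [mul_nonneg (sub_nonneg.2 hl1) (add_nonneg (hJ u) (sq_nonneg ‖J u‖))]
  let e := hcoer.continuousLinearEquivOfBilin
  have he : ∀ v, e v = M v := fun v => by
    refine ext_inner_right ℝ fun w => ?_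
    rw [hcoer.continuousLinearEquivOfBilin_apply]
    rfl
  refine ⟨(e.symm : H →L[ℝ] H), ?_, ?_⟩
  · ext v
    change M (e.symm v) = v
    rw [← he, e.apply_symm_apply]
  · ext v
    change e.symm (M v) = v
    rw [← he, e.symm_apply_apply]

/-- The Yosida approximations of the operator `J⁻¹ - I`. -/
theorem exists_yosida_approximation (hJ : ∀ y, 0 ≤ inner ℝ (y - J y) (J y))
    (hinj : ∀ y, J y = 0 → y = 0) :
    ∃ B : ℕ → H →L[ℝ] H, (∀ k x, 0 ≤ inner ℝ (B k x) x) ∧ (∀ k l, Commute (B k) (B l)) ∧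
      (∀ k, Commute (B k) J) ∧ (∀ k z, ‖B k (J z)‖ ≤ ‖z - J z‖) ∧
      ∀ z, Tendsto (fun k => B k (J z)) atTop (𝓝 (z - J z)) := by
  -- For A = J⁻¹ - I, the Yosida approximation A(I + lA)⁻¹ equals (1 - J)R with R the inverse of l +
  -- (1-l)J, and JR = (I + lA)⁻¹. Only bounded operators appear in this form.
  set l : ℕ → ℝ := fun k => 1 / ((k : ℝ) + 1) with hl
  have hl0 : ∀ k, 0 < l k := fun k => by positivity
  have hl1 : ∀ k, l k ≤ 1 := fun k => by
    rw [hl]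
    simp only
    rw [div_le_one (by positivity)]
    linarith [(Nat.cast_nonneg k : (0 : ℝ) ≤ k)]
  choose R hMR hRM using fun k => exists_inverse_smul_add_smul_resolvent hJ (hl0 k) (hl1 k)
  set M : ℕ → H →L[ℝ] H := fun k => l k • (1 : H →L[ℝ] H) + (1 - l k) • J with hM
  have hcomm : ∀ (k : ℕ) (C : H →L[ℝ] H), Commute C J → Commute C (R k) := fun k C hC => by
    have h1 : Commute C (M k) :=
      ((Commute.one_right C).smul_right _).add_right (hC.smul_right _)
    calc C * R k = R k * M k * C * R k := by rw [hRM, one_mul]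
      _ = R k * (C * M k) * R k := by rw [h1.eq]; noncomm_ring
      _ = R k * C * (M k * R k) := by noncomm_ring
      _ = R k * C := by rw [hMR, mul_one]
  have hJR : ∀ k, Commute J (R k) := fun k => hcomm k J (Commute.refl J)
  have hRR : ∀ k j, Commute (R k) (R j) := fun k j => hcomm j (R k) (hJR k).symm
  have h1J : ∀ k, Commute (1 - J) (R k) := fun k => (Commute.one_left _).sub_left (hJR k)
  have hMR' : ∀ k x, l k • R k x + (1 - l k) • J (R k x) = x := fun k x => by
    simpa using DFunLike.congr_fun (hMR k) x
  have hJRle : ∀ k x, ‖J (R k x)‖ ≤ ‖x‖ := fun k x => by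
    have := norm_le_norm_smul_add_smul_resolvent hJ (hl0 k).le (R k x)
    rwa [hMR'] at this
  have hJR' : ∀ k x, R k (J x) = J (R k x) := fun k x =>
    (DFunLike.congr_fun (hJR k).eq x).symm
  have hBJ : ∀ k z, ((1 - J) * R k) (J z) = J (R k (z - J z)) := fun k z => by
    simp [hJR']
  -- The operators (I + lA)⁻¹ tend strongly to the identity: at rate l on the range of J, then
  -- everywhere by density and contractivity.
  have hJRt : ∀ y, Tendsto (fun k => J (R k y)) atTop (𝓝 y) := by
    have hdense := denseRange_resolvent hJ hinj
    have hsub : ∀ k z, ‖J (R k (J z)) - J z‖ ≤ l k * ‖J z - z‖ := fun k z => by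
      have h1 : J (R k (J z)) - J z = l k • J (R k (J z - z)) := by
        have h2 := congrArg J (hMR' k z)
        simp only [map_add, map_smul] at h2
        simp only [map_sub, hJR']
        rw [← h2]
        module
      rw [h1, norm_smul, Real.norm_of_nonneg (hl0 k).le]
      exact mul_le_mul_of_nonneg_left (hJRle k _) (hl0 k).le
    have hl_tendsto : Tendsto l atTop (𝓝 0) := tendsto_one_div_add_atTop_nhds_zero_nat
    intro y
    rw [Metric.tendsto_atTop]
    intro ε hε
    obtain ⟨z, hz⟩ := hdense.exists_dist_lt y (show 0 < ε / 3 by positivity)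
    have h3 : Tendsto (fun k => l k * ‖J z - z‖) atTop (𝓝 0) := by
      simpa using hl_tendsto.mul_const ‖J z - z‖
    obtain ⟨N, hN⟩ := (h3.eventually (gt_mem_nhds (show 0 < ε / 3 by positivity))).exists_forall_of_atTop
    refine ⟨N, fun k hk => ?_⟩
    have e1 : J (R k y) - y = J (R k (y - J z)) + (J (R k (J z)) - J z) + (J z - y) := by
      simp
    rw [dist_eq_norm, e1]
    rw [dist_eq_norm] at hz
    have := hJRle k (y - J z)
    have := hsub k z
    have := hN k hk
    calc _ ≤ ‖J (R k (y - J z))‖ + ‖J (R k (J z)) - J z‖ + ‖J z - y‖ := norm_add₃_le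
      _ < ε := by rw [norm_sub_rev (J z) y]; linarith
  refine ⟨fun k => (1 - J) * R k, fun k x => ?_, fun k j => ?_, fun k => ?_, fun k z => ?_,
    fun z => ?_⟩
  · have h1 : inner ℝ (((1 - J) * R k) x) x =
        l k * inner ℝ (R k x - J (R k x)) (R k x) +
          (1 - l k) * inner ℝ (R k x - J (R k x)) (J (R k x)) := by
      rw [← inner_smul_right, ← inner_smul_right, ← inner_add_right, hMR' k x]
      rfl
    rw [h1]
    exact add_nonneg (mul_nonneg (hl0 k).le (inner_sub_resolvent_self_nonneg hJ _))
      (mul_nonneg (sub_nonneg.2 (hl1 k)) (hJ _))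
  · exact ((Commute.refl (1 - J)).mul_left (h1J k).symm).mul_right
      ((h1J j).mul_left (hRR k j))
  · exact ((Commute.one_left J).sub_left (Commute.refl J)).mul_left (hJR k).symm
  · simp only [hBJ]
    exact hJRle k _
  · simp only [hBJ]
    exact hJRt _

end Yosida

/-! ### Generation of contraction semigroups -/

section Generation

/-- Uniformly bounded operators which tend to `0` on a dense set do so everywhere. -/
theorem tendsto_zero_of_denseRange {H : Type*} [NormedAddCommGroup H] {ι : Type*} {F : Filter ι} {Q : ι → H → H} {J : H → H}
    (hJ : DenseRange J) {C : ℝ} (hC : 0 < C)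
    (hQ : ∀ᶠ i in F, ∀ x y, ‖Q i x - Q i y‖ ≤ C * ‖x - y‖)
    (h : ∀ z, Tendsto (fun i => Q i (J z)) F (𝓝 0)) (x : H) :
    Tendsto (fun i => Q i x) F (𝓝 0) := by
  rw [Metric.tendsto_nhds]
  intro ε hε
  obtain ⟨z, hz⟩ := hJ.exists_dist_lt x (show 0 < ε / (2 * C) by positivity)
  filter_upwards [hQ, Metric.tendsto_nhds.1 (h z) (ε / 2) (by positivity)] with i h1 h2
  rw [dist_zero_right] at h2 ⊢
  rw [dist_eq_norm, lt_div_iff₀ (by positivity)] at hz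
  have h3 := h1 x (J z)
  have h4 := norm_sub_norm_le (Q i x) (Q i (J z))
  nlinarith

variable {H : Type*} [NormedAddCommGroup H] [InnerProductSpace ℝ H]

/-- A sequence of linear contractions which is Cauchy on a dense set is Cauchy everywhere. -/
theorem cauchySeq_apply_of_denseRange {T : ℕ → H →L[ℝ] H} (hT : ∀ k x, ‖T k x‖ ≤ ‖x‖)
    {J : H → H} (hJ : DenseRange J) (h : ∀ z, CauchySeq fun k => T k (J z)) (x : H) :
    CauchySeq fun k => T k x := by
  rw [Metric.cauchySeq_iff]
  intro ε hε
  obtain ⟨z, hz⟩ := hJ.exists_dist_lt x (show 0 < ε / 3 by positivity)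
  obtain ⟨N, hN⟩ := Metric.cauchySeq_iff.1 (h z) (ε / 3) (by positivity)
  refine ⟨N, fun m hm k hk => ?_⟩
  have h1 := hN m hm k hk
  have h2 := hT m (x - J z)
  have h3 := hT k (x - J z)
  rw [dist_eq_norm] at h1 hz ⊢
  rw [map_sub] at h2 h3
  calc ‖T m x - T k x‖
      = ‖(T m x - T m (J z)) + (T m (J z) - T k (J z)) - (T k x - T k (J z))‖ := by
        congr 1; abel
    _ ≤ ‖T m x - T m (J z)‖ + ‖T m (J z) - T k (J z)‖ + ‖T k x - T k (J z)‖ :=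
        (norm_sub_le _ _).trans (add_le_add_left (norm_add_le _ _) _)
    _ < ε := by linarith

variable [CompleteSpace H]

/-- On the range of J the Yosida exponentials are Cauchy, because the approximations commute and
converge there; contractivity and density extend the limit to all of H. -/
theorem exists_contractionSemigroup_of_resolvent {J : H →L[ℝ] H}
    (hJ : ∀ y, 0 ≤ inner ℝ (y - J y) (J y)) (hinj : ∀ y, J y = 0 → y = 0) :
    ∃ S : ℝ → H →L[ℝ] H, IsContractionSemigroup S ∧
      ∀ z, Tendsto (fun h : ℝ => h⁻¹ • (S h (J z) - J z)) (𝓝[>] 0) (𝓝 (-(z - J z))) := by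
  obtain ⟨B, hacc, hcomm, hBJ, hbound, hlim⟩ := exists_yosida_approximation hJ hinj
  have hdense := denseRange_resolvent hJ hinj
  have hcontr : ∀ k {t : ℝ}, 0 ≤ t → ∀ x, ‖expNeg (B k) t x‖ ≤ ‖x‖ := fun k t ht x =>
    norm_expNeg_apply_le (hacc k) ht x
  have hex : ∀ t : ℝ, ∃ L : H →L[ℝ] H, 0 ≤ t →
      ∀ x, Tendsto (fun k => expNeg (B k) t x) atTop (𝓝 (L x)) := by
    intro t
    by_cases ht : 0 ≤ t
    swap
    · exact ⟨0, fun h => absurd h ht⟩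
    have hc : ∀ x, CauchySeq fun k => expNeg (B k) t x := by
      refine cauchySeq_apply_of_denseRange (fun k => hcontr k ht) hdense fun z => ?_
      rw [Metric.cauchySeq_iff]
      intro ε hε
      obtain ⟨N, hN⟩ := Metric.cauchySeq_iff.1 (hlim z).cauchySeq (ε / (t + 1)) (by positivity)
      refine ⟨N, fun m hm k hk => ?_⟩
      have h1 := hN m hm k hk
      rw [dist_eq_norm, lt_div_iff₀ (by positivity)] at h1
      rw [dist_eq_norm]
      have h2 := norm_expNeg_sub_expNeg_le (hacc m) (hacc k) (hcomm m k) ht (J z)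
      nlinarith [norm_nonneg (B m (J z) - B k (J z))]
    choose f hf using fun x => cauchySeq_tendsto_of_complete (hc x)
    exact ⟨continuousLinearMapOfTendsto (fun k => expNeg (B k) t) (tendsto_pi_nhds.2 hf),
      fun _ x => hf x⟩
  choose S hS using hex
  have hScontr : ∀ t, 0 ≤ t → ∀ x, ‖S t x‖ ≤ ‖x‖ := fun t ht x =>
    le_of_tendsto (hS t ht x).norm (Eventually.of_forall fun k => hcontr k ht x)
  have hadd : ∀ s t : ℝ, 0 ≤ s → 0 ≤ t → S (s + t) = (S s).comp (S t) := by
    intro s t hs ht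
    ext x
    refine tendsto_nhds_unique (hS (s + t) (add_nonneg hs ht) x) ?_
    have h1 : Tendsto (fun k => expNeg (B k) s (expNeg (B k) t x - S t x)) atTop (𝓝 0) := by
      refine squeeze_zero_norm (fun k => hcontr k hs _) ?_
      simpa using ((hS t ht x).sub_const (S t x)).norm
    have h2 := h1.add (hS s hs (S t x))
    rw [zero_add] at h2
    refine h2.congr fun k => ?_
    rw [expNeg_add, map_sub, sub_add_cancel]
    rfl
  have hlip0 : ∀ h, 0 ≤ h → ∀ z, ‖S h (J z) - J z‖ ≤ h * ‖z - J z‖ := fun h hh z =>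
    le_of_tendsto ((hS h hh (J z)).sub_const (J z)).norm (Eventually.of_forall fun k =>
      (norm_expNeg_sub_self_le (hacc k) hh (J z)).trans
        (mul_le_mul_of_nonneg_left (hbound k z) hh))
  have hlip : ∀ s t, 0 ≤ s → s ≤ t → ∀ z, ‖S t (J z) - S s (J z)‖ ≤ (t - s) * ‖z - J z‖ := by
    intro s t hs hst z
    have h1 : S t (J z) - S s (J z) = S s (S (t - s) (J z) - J z) := by
      have := hadd s (t - s) hs (sub_nonneg.2 hst)
      rw [add_sub_cancel] at this
      rw [this, map_sub]
      rfl
    rw [h1]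
    exact (hScontr s hs _).trans (hlip0 _ (sub_nonneg.2 hst) z)
  have hcontJ : ∀ z, ContinuousOn (fun t => S t (J z)) (Ici 0) := fun z => by
    refine LipschitzOnWith.continuousOn (K := ‖z - J z‖₊) (LipschitzOnWith.of_dist_le_mul ?_)
    intro t ht s hs
    rw [dist_eq_norm, Real.dist_eq, coe_nnnorm, mul_comm]
    rcases le_total s t with h | h
    · rw [abs_of_nonneg (sub_nonneg.2 h)]
      exact hlip s t hs h z
    · rw [abs_sub_comm, abs_of_nonneg (sub_nonneg.2 h), norm_sub_rev]
      exact hlip t s ht h z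
  refine ⟨S, ⟨?_, hadd, fun x => ?_, hScontr⟩, fun z => ?_⟩
  · ext x
    refine tendsto_nhds_unique (hS 0 le_rfl x) ?_
    simp [expNeg_zero]
  · refine continuousOn_of_uniform_approx_of_continuousOn fun u hu => ?_
    obtain ⟨ε, hε, hu'⟩ := Metric.mem_uniformity_dist.1 hu
    obtain ⟨z, hz⟩ := hdense.exists_dist_lt x hε
    refine ⟨_, hcontJ z, fun t ht => hu' ?_⟩
    rw [dist_eq_norm] at hz ⊢
    rw [← map_sub]
    exact (hScontr t ht _).trans_lt hz
  -- `Q h` is the error of the difference quotient at `J w`. It is bounded uniformly in h by the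
  -- Lipschitz estimate `hlip0`, so convergence need only be checked on a dense set. For w in the
  -- range of J, the second-order Taylor bound makes it O(h).
  · set Q : ℝ → H → H := fun h w => h⁻¹ • (S h (J w) - J w) + (w - J w) with hQ
    have hQsub : ∀ h x y, Q h x - Q h y = Q h (x - y) := fun h x y => by
      simp only [hQ, map_sub]
      module
    have hI : ∀ w, ‖w - J w‖ ≤ ‖(1 : H →L[ℝ] H) - J‖ * ‖w‖ := fun w =>
      ((1 : H →L[ℝ] H) - J).le_opNorm w
    have hmain : Tendsto (fun h => Q h z) (𝓝[>] 0) (𝓝 0) := by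
      refine tendsto_zero_of_denseRange hdense (C := 2 * ‖(1 : H →L[ℝ] H) - J‖ + 1)
        (by positivity) ?_ (fun w => ?_) z
      · filter_upwards [self_mem_nhdsWithin] with h hh x y
        have hh : 0 < h := hh
        rw [hQsub]
        have h1 := hlip0 h hh.le (x - y)
        have h2 := hI (x - y)
        have h3 : ‖h⁻¹ • (S h (J (x - y)) - J (x - y))‖ ≤ ‖(x - y) - J (x - y)‖ := by
          rw [norm_smul, norm_inv, Real.norm_of_nonneg hh.le, inv_mul_le_iff₀ hh]
          exact h1
        calc _ ≤ ‖h⁻¹ • (S h (J (x - y)) - J (x - y))‖ + ‖(x - y) - J (x - y)‖ :=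
              norm_add_le _ _
          _ ≤ _ := by nlinarith [norm_nonneg (x - y)]
      · set v := w - J w with hv
        have hk : ∀ k, B k (B k (J (J w))) = B k (J (B k (J w))) := fun k => by
          congr 1
          exact DFunLike.congr_fun (hBJ k).eq (J w)
        have hC : ∀ k, ‖B k (B k (J (J w)))‖ ≤ ‖(1 : H →L[ℝ] H) - J‖ * ‖v‖ := fun k => by
          rw [hk]
          exact (hbound k _).trans ((hI _).trans
            (mul_le_mul_of_nonneg_left (hbound k w) (norm_nonneg _)))
        have hq : ∀ h, 0 < h → ‖Q h (J w)‖ ≤ h * (‖(1 : H →L[ℝ] H) - J‖ * ‖v‖) := by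
          intro h hh
          have h1 : ‖S h (J (J w)) - J (J w) + h • (J w - J (J w))‖ ≤
              h ^ 2 * (‖(1 : H →L[ℝ] H) - J‖ * ‖v‖) := by
            refine le_of_tendsto (((hS h hh.le (J (J w))).sub_const (J (J w))).add
              ((hlim (J w)).const_smul h)).norm (Eventually.of_forall fun k => ?_)
            exact (norm_expNeg_sub_taylor_le (hacc k) hh.le _).trans
              (mul_le_mul_of_nonneg_left (hC k) (sq_nonneg h))
          have h2 : Q h (J w) = h⁻¹ • (S h (J (J w)) - J (J w) + h • (J w - J (J w))) := by
            rw [smul_add, inv_smul_smul₀ hh.ne']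
          rw [h2, norm_smul, norm_inv, Real.norm_of_nonneg hh.le, inv_mul_le_iff₀ hh]
          linarith
        refine squeeze_zero_norm' (a := fun h => h * (‖(1 : H →L[ℝ] H) - J‖ * ‖v‖)) ?_ ?_
        · filter_upwards [self_mem_nhdsWithin] with h hh using hq h hh
        · have : Tendsto (fun h : ℝ => h * (‖(1 : H →L[ℝ] H) - J‖ * ‖v‖)) (𝓝 0) (𝓝 0) := by
            simpa using (tendsto_id (x := 𝓝 (0 : ℝ))).mul_const (‖(1 : H →L[ℝ] H) - J‖ * ‖v‖)
          exact this.mono_left nhdsWithin_le_nhds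
    have h1 := hmain.sub_const (z - J z)
    rw [zero_sub] at h1
    simpa [hQ] using h1

/-- An m-accretive operator on a Hilbert space generates a contraction semigroup. -/
theorem IsMAccretive.exists_contractionSemigroup {A : H →ₗ.[ℝ] H} (hA : IsMAccretive A) :
    ∃ S : ℝ → H →L[ℝ] H, IsContractionSemigroup S ∧ HasGeneratorNeg A S := by
  obtain ⟨J, hJ, hinj, hgraph⟩ := hA.exists_resolvent
  obtain ⟨S, hS, hgen⟩ := exists_contractionSemigroup_of_resolvent hJ hinj
  refine ⟨S, hS, fun x y => ⟨fun h => ?_, fun h => ?_⟩⟩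
  · have h1 := hgen (x + y)
    rwa [(hgraph x y).1 h, add_sub_cancel_left] at h1
  -- The generator cannot properly extend -A: this u would be an eigenvector of the generator with
  -- eigenvalue 1, while contractivity makes the generator dissipative. Hence u = 0.
  · set u := x - J (x + y) with hu
    have h1 : Tendsto (fun h : ℝ => h⁻¹ • (S h u - u)) (𝓝[>] 0) (𝓝 u) := by
      have := h.sub (hgen (x + y))
      rw [show -y - -(x + y - J (x + y)) = u by rw [hu]; abel] at this
      refine this.congr fun t => ?_
      rw [hu, map_sub]
      module
    have h2 : Tendsto (fun h : ℝ => inner ℝ (h⁻¹ • (S h u - u)) u) (𝓝[>] 0)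
        (𝓝 (inner ℝ u u)) := h1.inner tendsto_const_nhds
    have h3 : inner ℝ u u ≤ 0 := by
      refine le_of_tendsto h2 ?_
      filter_upwards [self_mem_nhdsWithin] with t ht
      have ht : 0 < t := ht
      rw [inner_smul_left, inner_sub_left, real_inner_self_eq_norm_sq]
      have h4 := real_inner_le_norm (S t u) u
      have h5 := hS.contraction t ht.le u
      have h6 : inner ℝ (S t u) u - ‖u‖ ^ 2 ≤ 0 := by nlinarith [norm_nonneg u]
      exact mul_nonpos_of_nonneg_of_nonpos (by simpa using ht.le) h6
    have h4 : u = 0 := by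
      rw [real_inner_self_eq_norm_sq] at h3
      exact norm_eq_zero.1 (by nlinarith [norm_nonneg u])
    rw [hgraph]
    exact (sub_eq_zero.1 h4).symm

end Generation

/-! ### Uniqueness of the semigroup with a given generator -/

section Uniqueness

variable {H : Type*} [NormedAddCommGroup H] [InnerProductSpace ℝ H]

/-- Strong continuity at a fixed vector plus equicontinuity of the contractions. -/
theorem IsContractionSemigroup.continuousOn_uncurry {S : ℝ → H →L[ℝ] H}
    (hS : IsContractionSemigroup S) :
    ContinuousOn (fun p : ℝ × H => S p.1 p.2) (Ici 0 ×ˢ univ) := by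
  rintro ⟨t, x⟩ ⟨ht, -⟩
  have ht : 0 ≤ t := ht
  have h1 : Tendsto (fun p : ℝ × H => S p.1 x) (𝓝[Ici 0 ×ˢ univ] (t, x)) (𝓝 (S t x)) := by
    refine (hS.strongly_continuous x t ht).tendsto.comp ?_
    refine tendsto_nhdsWithin_iff.2 ⟨?_, ?_⟩
    · exact (continuous_fst.tendsto (t, x)).mono_left nhdsWithin_le_nhds
    · filter_upwards [self_mem_nhdsWithin] with p hp using hp.1
  have h2 : Tendsto (fun p : ℝ × H => S p.1 (p.2 - x)) (𝓝[Ici 0 ×ˢ univ] (t, x)) (𝓝 0) := by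
    refine squeeze_zero_norm' (a := fun p => ‖p.2 - x‖) ?_ ?_
    · filter_upwards [self_mem_nhdsWithin] with p hp using hS.contraction _ hp.1 _
    · have : Continuous fun p : ℝ × H => ‖p.2 - x‖ := by fun_prop
      simpa using (this.tendsto (t, x)).mono_left nhdsWithin_le_nhds
  have h3 := h1.add h2
  rw [add_zero] at h3
  refine h3.congr fun p => ?_
  rw [map_sub, add_sub_cancel]

/-- A contraction semigroup is determined by its generator. -/
theorem HasGeneratorNeg.apply_eq [CompleteSpace H] {A : H →ₗ.[ℝ] H} (hA : IsMAccretive A)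
    {S T : ℝ → H →L[ℝ] H} (hS : IsContractionSemigroup S) (hT : IsContractionSemigroup T)
    (hSA : HasGeneratorNeg A S) (hTA : HasGeneratorNeg A T) {t : ℝ} (ht : 0 ≤ t) :
    S t = T t := by
  obtain ⟨J, hJ, hinj, hgraph⟩ := hA.exists_resolvent
  have hmem : ∀ y, (J y, y - J y) ∈ A.graph := fun y => by
    rw [hgraph, add_sub_cancel]
  have hdense := denseRange_resolvent hJ hinj
  suffices h : (S t : H → H) = T t from DFunLike.coe_injective h
  refine hdense.equalizer (S t).continuous (T t).continuous (funext fun z => ?_)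
  change S t (J z) = T t (J z)
  -- `T s` commutes with its own difference quotients, so orbits starting in the domain stay there.
  -- Both generators can then be evaluated along the orbit and cancel in the right derivative below.
  have hinv : ∀ s, 0 ≤ s → (T s (J z), T s (z - J z)) ∈ A.graph := fun s hs => by
    rw [hTA]
    have h1 := ((T s).continuous.tendsto _).comp ((hTA _ _).1 (hmem z))
    rw [map_neg] at h1
    refine h1.congr' ?_
    filter_upwards [self_mem_nhdsWithin] with h hh
    have hh : 0 < h := hh
    have e1 : T s (T h (J z)) = T h (T s (J z)) := by
      have := (hT.map_add s h hs hh.le).symm.trans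
        ((congrArg T (add_comm s h)).trans (hT.map_add h s hh.le hs))
      exact DFunLike.congr_fun this (J z)
    simp [e1]
  have hcont : ContinuousOn (fun s => S (t - s) (T s (J z))) (Icc 0 t) := by
    refine hS.continuousOn_uncurry.comp (f := fun s => (t - s, T s (J z))) ?_ ?_
    · exact (continuousOn_const.sub continuousOn_id).prodMk
        ((hT.strongly_continuous _).mono Icc_subset_Ici_self)
    · intro s hs
      exact ⟨sub_nonneg.2 hs.2, mem_univ _⟩
  have hderiv : ∀ s ∈ Ico 0 t, HasDerivWithinAt (fun s => S (t - s) (T s (J z))) 0 (Ici s) s := by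
    rintro s ⟨hs, hst⟩
    rw [← hasDerivWithinAt_Ioi_iff_Ici, hasDerivWithinAt_iff_tendsto_slope' (by simp)]
    set x := T s (J z) with hx
    have h1 : Tendsto (fun h : ℝ => h⁻¹ • (T h x - x) - h⁻¹ • (S h x - x)) (𝓝[>] 0) (𝓝 0) := by
      have := ((hTA _ _).1 (hinv s hs)).sub ((hSA _ _).1 (hinv s hs))
      rwa [sub_self] at this
    have hsub : Tendsto (fun r => r - s) (𝓝[>] s) (𝓝[>] 0) := by
      refine tendsto_nhdsWithin_iff.2 ⟨?_, ?_⟩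
      · have : Tendsto (fun r => r - s) (𝓝 s) (𝓝 (s - s)) := tendsto_id.sub_const s
        rw [sub_self] at this
        exact this.mono_left nhdsWithin_le_nhds
      · filter_upwards [self_mem_nhdsWithin] with r hr using sub_pos.2 (mem_Ioi.1 hr)
    refine squeeze_zero_norm' ?_ (by simpa using (h1.comp hsub).norm)
    filter_upwards [self_mem_nhdsWithin, Ioo_mem_nhdsGT hst] with r hr hrt
    have hr' : 0 < r - s := sub_pos.2 hr
    have e1 : T r (J z) = T (r - s) x := by
      have := hT.map_add (r - s) s hr'.le hs
      rw [sub_add_cancel] at this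
      rw [this]
      rfl
    have e2 : S (t - s) x = S (t - r) (S (r - s) x) := by
      have := hS.map_add (t - r) (r - s) (by linarith [hrt.2]) hr'.le
      rw [sub_add_sub_cancel] at this
      rw [this]
      rfl
    have e3 : slope (fun s => S (t - s) (T s (J z))) s r =
        S (t - r) ((r - s)⁻¹ • (T (r - s) x - x) - (r - s)⁻¹ • (S (r - s) x - x)) := by
      rw [slope_def_module, e1, ← hx, e2, ← smul_sub, map_smul, ← map_sub]
      simp
    rw [e3]
    exact hS.contraction _ (by linarith [hrt.2]) _
  have := constant_of_has_deriv_right_zero hcont hderiv t ⟨ht, le_rfl⟩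
  simpa [hS.map_zero, hT.map_zero] using this.symm

end Uniqueness

/-! ### Duhamel's formula -/

section Duhamel

/-- Integration by parts against the primitive of an integrable vector-valued function. -/
theorem integral_deriv_smul_primitive {E : Type*} [NormedAddCommGroup E] [NormedSpace ℝ E]
    [CompleteSpace E] {e e' : ℝ → ℝ} (he : ∀ s, HasDerivAt e (e' s) s) (he' : Continuous e')
    {a b : ℝ} (hab : a ≤ b) {h : ℝ → E} (hh : IntervalIntegrable h volume a b) :
    ∫ s in a..b, e' s • ∫ r in a..s, h r =
      e b • (∫ r in a..b, h r) - ∫ r in a..b, e r • h r := by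
  have hec : Continuous e := continuous_iff_continuousAt.2 fun s => (he s).continuousAt
  have hftc : ∀ r, ∫ s in r..b, e' s = e b - e r := fun r =>
    intervalIntegral.integral_eq_sub_of_hasDerivAt (fun s _ => he s) (he'.intervalIntegrable r b)
  have h1 : e b • (∫ r in a..b, h r) - ∫ r in a..b, e r • h r =
      ∫ r in a..b, (∫ s in r..b, e' s) • h r := by
    rw [← intervalIntegral.integral_smul, ← intervalIntegral.integral_sub
      (f := fun r => e b • h r) (hh.smul (e b)) (hh.continuousOn_smul hec.continuousOn)]
    simp only [hftc, sub_smul]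
  rw [h1, intervalIntegral.integral_of_le hab, intervalIntegral.integral_of_le hab]
  set μ := volume.restrict (Ioc a b) with hμ
  -- Both sides integrate e'(s)h(r) over the triangle r ≤ s.
  set D : Set (ℝ × ℝ) := {p | p.2 ≤ p.1} with hD
  have hDm : MeasurableSet D := measurableSet_le measurable_snd measurable_fst
  have hint : Integrable (Function.uncurry fun s r => D.indicator (fun p => e' p.1 • h p.2) (s, r))
      (μ.prod μ) := by
    have := Integrable.smul_prod (μ := μ) (ν := μ) he'.integrableOn_Ioc
      ((intervalIntegrable_iff_integrableOn_Ioc_of_le hab).1 hh)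
    exact this.indicator hDm
  have hswap := integral_integral_swap hint
  have hl : ∀ s ∈ Ioc a b, (e' s • ∫ r in a..s, h r) =
      ∫ r, D.indicator (fun p => e' p.1 • h p.2) (s, r) ∂μ := by
    intro s hs
    have : (fun r => D.indicator (fun p => e' p.1 • h p.2) (s, r)) =
        (Iic s).indicator fun r => e' s • h r := rfl
    rw [this, hμ, setIntegral_indicator measurableSet_Iic, Ioc_inter_Iic, min_eq_right hs.2,
      integral_smul, intervalIntegral.integral_of_le hs.1.le]
  have hr : ∀ r ∈ Ioc a b, (∫ s in r..b, e' s) • h r =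
      ∫ s, D.indicator (fun p => e' p.1 • h p.2) (s, r) ∂μ := by
    intro r hr
    have h2 : (fun s => D.indicator (fun p => e' p.1 • h p.2) (s, r)) =
        (Ici r).indicator fun s => e' s • h r := rfl
    have h3 : Ioc a b ∩ Ici r = Icc r b := by
      ext s
      exact ⟨fun hs => ⟨hs.2, hs.1.2⟩, fun hs => ⟨⟨hr.1.trans_le hs.1, hs.2⟩, hs.1⟩⟩
    rw [h2, hμ, setIntegral_indicator measurableSet_Ici, h3, integral_Icc_eq_integral_Ioc,
      integral_smul_const, intervalIntegral.integral_of_le hr.2]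
  rw [setIntegral_congr_fun measurableSet_Ioc hl, setIntegral_congr_fun measurableSet_Ioc hr]
  exact hswap

variable {H : Type*} [NormedAddCommGroup H] [InnerProductSpace ℝ H]

/-- Values of S at negative times are arbitrary; clamping the time gives a globally continuous map,
suited to measurability and dominated convergence. -/
theorem IsContractionSemigroup.continuous_max {S : ℝ → H →L[ℝ] H}
    (hS : IsContractionSemigroup S) : Continuous fun p : ℝ × H => S (max 0 p.1) p.2 := by
  have := hS.continuousOn_uncurry.comp_continuous
    (f := fun p : ℝ × H => (max 0 p.1, p.2)) (by fun_prop)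
    fun p => ⟨mem_Ici.2 (le_max_left _ _), mem_univ _⟩
  exact this

theorem IsContractionSemigroup.aestronglyMeasurable_max {S : ℝ → H →L[ℝ] H}
    (hS : IsContractionSemigroup S) {μ : Measure ℝ} {w : ℝ → H} (hw : AEStronglyMeasurable w μ)
    (t : ℝ) : AEStronglyMeasurable (fun s => S (max 0 (t - s)) (w s)) μ := by
  have h1 : AEStronglyMeasurable (fun s : ℝ => t - s) μ :=
    (continuous_const.sub continuous_id).aestronglyMeasurable
  exact hS.continuous_max.comp_aestronglyMeasurable (h1.prodMk hw)

theorem IsContractionSemigroup.intervalIntegrable_apply {S : ℝ → H →L[ℝ] H}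
    (hS : IsContractionSemigroup S) {w : ℝ → H} {t₀ a t : ℝ} (hat : a ≤ t) (ht₀ : t₀ ≤ a)
    (hw : IntervalIntegrable w volume t₀ a) :
    IntervalIntegrable (fun s => S (t - s) (w s)) volume t₀ a := by
  rw [intervalIntegrable_iff_integrableOn_Ioc_of_le ht₀] at hw ⊢
  have h1 : IntegrableOn (fun s => S (max 0 (t - s)) (w s)) (Ioc t₀ a) :=
    Integrable.mono' hw.norm (hS.aestronglyMeasurable_max hw.aestronglyMeasurable t)
      (Eventually.of_forall fun s => hS.contraction _ (le_max_left _ _) _)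
  refine h1.congr_fun (fun s hs => ?_) measurableSet_Ioc
  simp only
  rw [max_eq_right (by linarith [hs.2])]

/-- Dominated convergence on a fixed interval, the moving endpoint being encoded by an indicator;
for fixed s, the integrand can fail to be continuous at τ = t only if s = t, a null set. -/
theorem IsContractionSemigroup.continuousOn_duhamel {S : ℝ → H →L[ℝ] H}
    (hS : IsContractionSemigroup S) {t₀ : ℝ} (x₀ : H) {v : ℝ → H}
    (hv : ∀ t, t₀ ≤ t → IntervalIntegrable v volume t₀ t) :
    ContinuousOn (fun t => S (t - t₀) x₀ + ∫ s in t₀..t, S (t - s) (v s)) (Ici t₀) := by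
  refine ContinuousOn.add ?_ ?_
  · exact (hS.strongly_continuous x₀).comp (continuousOn_id.sub continuousOn_const)
      fun t ht => sub_nonneg.2 (mem_Ici.1 ht)
  intro t ht
  have ht : t₀ ≤ t := ht
  set b := t + 1 with hb
  have hvb : IntegrableOn v (Ioc t₀ b) :=
    (intervalIntegrable_iff_integrableOn_Ioc_of_le (by linarith)).1 (hv b (by linarith))
  set F : ℝ → ℝ → H := fun τ => (Iic τ).indicator fun s => S (max 0 (τ - s)) (v s) with hF
  have hcont : ContinuousAt (fun τ => ∫ s in Ioc t₀ b, F τ s) t := by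
    refine continuousAt_of_dominated (bound := fun s => ‖v s‖) ?_ ?_ hvb.norm ?_
    · exact Eventually.of_forall fun τ =>
        (hS.aestronglyMeasurable_max hvb.aestronglyMeasurable τ).indicator measurableSet_Iic
    · refine Eventually.of_forall fun τ => Eventually.of_forall fun s => ?_
      exact (norm_indicator_le_norm_self _ _).trans (hS.contraction _ (le_max_left _ _) _)
    · have hne : ∀ᵐ s ∂(volume.restrict (Ioc t₀ b)), s ≠ t :=
        ae_restrict_of_ae (Measure.ae_ne volume t)
      filter_upwards [hne] with s hs
      rcases lt_or_gt_of_ne hs with h | h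
      · have h1 : ContinuousAt (fun τ => S (max 0 (τ - s)) (v s)) t :=
          (hS.continuous_max.comp (f := fun τ : ℝ => (τ - s, v s)) (by fun_prop)).continuousAt
        refine h1.congr ?_
        filter_upwards [lt_mem_nhds h] with τ hτ
        simp [hF, hτ.le]
      · refine (continuousAt_const (y := (0 : H))).congr ?_
        filter_upwards [gt_mem_nhds h] with τ hτ
        simp [hF, hτ]
  have hformula : ∀ τ, t₀ ≤ τ → τ ≤ b →
      ∫ s in t₀..τ, S (τ - s) (v s) = ∫ s in Ioc t₀ b, F τ s := by
    intro τ h1 h2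
    simp only [hF]
    rw [setIntegral_indicator measurableSet_Iic, Ioc_inter_Iic, min_eq_right h2,
      intervalIntegral.integral_of_le h1]
    refine setIntegral_congr_fun measurableSet_Ioc fun s hs => ?_
    rw [max_eq_right (by linarith [hs.2])]
  refine hcont.continuousWithinAt.congr_of_eventuallyEq ?_ ?_
  · filter_upwards [self_mem_nhdsWithin, mem_nhdsWithin_of_mem_nhds (gt_mem_nhds
      (show t < b by linarith))] with τ h1 h2
    exact hformula τ h1 h2.le
  · exact hformula t ht (by linarith)

variable [CompleteSpace H]

/-- Duhamel's formula is invariant under multiplication by a scalar integrating factor. -/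
theorem IsContractionSemigroup.duhamel_smul {S : ℝ → H →L[ℝ] H}
    (hS : IsContractionSemigroup S) {f g e : ℝ → ℝ} (hf : Continuous f) (hg : Continuous g)
    (he : ∀ s, HasDerivAt e (g s * e s) s) {t₀ : ℝ} (he₀ : e t₀ = 1) {x₀ : H} {d X : ℝ → H}
    (hd : ∀ t, t₀ ≤ t → IntervalIntegrable d volume t₀ t) (hXc : ContinuousOn X (Ici t₀))
    (hX : ∀ t, t₀ ≤ t → X t = S (t - t₀) x₀ + ∫ s in t₀..t, S (t - s) (f s • X s + d s)) {t : ℝ}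
    (ht : t₀ ≤ t) :
    e t • X t = S (t - t₀) x₀ +
      ∫ s in t₀..t, S (t - s) ((f s + g s) • (e s • X s) + e s • d s) := by
  have hec : Continuous e := continuous_iff_continuousAt.2 fun s => (he s).continuousAt
  have hXi : ∀ a, t₀ ≤ a → IntervalIntegrable X volume t₀ a := fun a ha =>
    (hXc.mono (by rw [uIcc_of_le ha]; exact Icc_subset_Ici_self)).intervalIntegrable
  have hwi : ∀ a, t₀ ≤ a → IntervalIntegrable (fun s => f s • X s + d s) volume t₀ a :=
    fun a ha => ((hXi a ha).continuousOn_smul hf.continuousOn).add (hd a ha)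
  set h : ℝ → H := fun s => S (t - s) (f s • X s + d s) with hh
  have hhi : IntervalIntegrable h volume t₀ t := hS.intervalIntegrable_apply le_rfl ht (hwi t ht)
  -- Transporting the state at time s to the final time t turns Duhamel's formula into a plain
  -- primitive of `h`, to which integration by parts applies.
  have hprop : ∀ s ∈ uIcc t₀ t, S (t - s) (X s) = S (t - t₀) x₀ + ∫ r in t₀..s, h r := by
    rw [uIcc_of_le ht]
    rintro s ⟨h0s, hst⟩
    have hcomp : ∀ r, r ≤ s → ∀ x, S (t - s) (S (s - r) x) = S (t - r) x := fun r hr x => by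
      have := hS.map_add (t - s) (s - r) (sub_nonneg.2 hst) (sub_nonneg.2 hr)
      rw [sub_add_sub_cancel] at this
      exact (DFunLike.congr_fun this x).symm
    rw [hX s h0s, _root_.map_add, hcomp _ h0s, ← ContinuousLinearMap.intervalIntegral_comp_comm _
      (hS.intervalIntegrable_apply le_rfl h0s (hwi s h0s))]
    congr 1
    refine intervalIntegral.integral_congr fun r hr => ?_
    rw [uIcc_of_le h0s] at hr
    exact hcomp r hr.2 _
  have hge : Continuous fun s => g s * e s := hg.mul hec
  have hibp := integral_deriv_smul_primitive he hge ht hhi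
  have hsplit : ∫ s in t₀..t, S (t - s) ((f s + g s) • (e s • X s) + e s • d s) =
      ∫ s in t₀..t, (e s • h s + (g s * e s) • S (t - s) (X s)) := by
    refine intervalIntegral.integral_congr fun s _ => ?_
    have : (f s + g s) • (e s • X s) + e s • d s =
        e s • (f s • X s + d s) + (g s * e s) • X s := by module
    simp only [hh]
    rw [this, _root_.map_add, map_smul, map_smul]
  have hcongr : ∫ s in t₀..t, (g s * e s) • S (t - s) (X s) =
      ∫ s in t₀..t, ((g s * e s) • S (t - t₀) x₀ + (g s * e s) • ∫ r in t₀..s, h r) := by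
    refine intervalIntegral.integral_congr fun s hs => ?_
    simp only [hprop s hs, smul_add]
  have hprim : IntervalIntegrable (fun s => (g s * e s) • ∫ r in t₀..s, h r) volume t₀ t := by
    refine ContinuousOn.intervalIntegrable (hge.continuousOn.smul ?_)
    exact intervalIntegral.continuousOn_primitive_interval' hhi left_mem_uIcc
  rw [hsplit, intervalIntegral.integral_add (hhi.continuousOn_smul hec.continuousOn)
    ((hS.intervalIntegrable_apply le_rfl ht (hXi t ht)).continuousOn_smul hge.continuousOn),
    hcongr, intervalIntegral.integral_add (f := fun s => (g s * e s) • S (t - t₀) x₀)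
      ((hge.smul continuous_const).intervalIntegrable _ _) hprim, hibp, intervalIntegral.integral_smul_const,
    intervalIntegral.integral_eq_sub_of_hasDerivAt (fun s _ => he s)
      (hge.intervalIntegrable _ _), he₀, hX t ht]
  simp only [hh]
  module

end Duhamel

/-! ### Mild solutions -/

section Disturbance

variable {H : Type*} [NormedAddCommGroup H]

theorem IsDisturbance.intervalIntegrable {d : ℝ → H} (hd : IsDisturbance d) {a b : ℝ}
    (ha : 0 ≤ a) (hab : a ≤ b) : IntervalIntegrable d volume a b := by
  rw [intervalIntegrable_iff_integrableOn_Ioc_of_le hab]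
  have h1 : MemLp d ∞ (volume.restrict (Ioc a b)) :=
    hd.mono_measure (Measure.restrict_mono_set _ fun s hs => ha.trans hs.1.le)
  exact h1.integrable le_top

theorem IsDisturbance.ae_norm_le {d : ℝ → H} (hd : IsDisturbance d) :
    ∀ᵐ s, 0 ≤ s → ‖d s‖ ≤ supNorm d := by
  have h1 : ∀ᵐ s ∂(volume.restrict (Ici (0 : ℝ))), ‖d s‖ ≤ supNorm d := by
    filter_upwards [ae_le_eLpNormEssSup (f := d) (μ := volume.restrict (Ici (0 : ℝ)))] with s hs
    rw [← eLpNorm_exponent_top] at hs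
    have := ENNReal.toReal_mono hd.2.ne hs
    simpa [supNorm] using this
  rw [ae_restrict_iff' measurableSet_Ici] at h1
  exact h1

theorem supNorm_nonneg (d : ℝ → H) : 0 ≤ supNorm d := ENNReal.toReal_nonneg

end Disturbance

section Mild

variable {H : Type*} [NormedAddCommGroup H] [InnerProductSpace ℝ H] [CompleteSpace H]
  {A : H →ₗ.[ℝ] H} {f F : ℝ → ℝ} {d X : ℝ → H} {t₀ : ℝ} {x₀ : H}

/-- The variation of constants formula for a mild solution of `X' + A X = f(t) X + d`. -/
theorem IsMildSolution.exists_variation_of_constants (hX : IsMildSolution A f d t₀ x₀ X)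
    (hf : Continuous f) (hF : ∀ s, HasDerivAt F (f s) s) (ht₀ : 0 ≤ t₀) (hd : IsDisturbance d) :
    ∃ S : ℝ → H →L[ℝ] H, IsContractionSemigroup S ∧ HasGeneratorNeg A S ∧ ∀ t, t₀ ≤ t →
      Real.exp (F t₀ - F t) • X t =
        S (t - t₀) x₀ + ∫ s in t₀..t, S (t - s) (Real.exp (F t₀ - F s) • d s) := by
  obtain ⟨S, hS, hSA, hXc, hXeq⟩ := hX
  refine ⟨S, hS, hSA, fun t ht => ?_⟩
  have he : ∀ s, HasDerivAt (fun s => Real.exp (F t₀ - F s))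
      (-f s * Real.exp (F t₀ - F s)) s := fun s => by
    have := ((hF s).const_sub (F t₀)).exp
    rwa [mul_comm] at this
  have := hS.duhamel_smul hf hf.neg he (by simp)
    (fun t ht => hd.intervalIntegrable ht₀ ht) hXc hXeq ht
  simpa using this

/-- The integrating factor gives a bijection with the mild solutions of the problem without
feedback, where Duhamel's formula is explicit. -/
theorem isWellPosed_of_continuous (hA : IsMAccretive A) (hf : Continuous f) :
    IsWellPosed A f := by
  intro t₀ x₀ d ht₀ hd
  obtain ⟨F, hF⟩ : ∃ F : ℝ → ℝ, ∀ s, HasDerivAt F (f s) s :=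
    ⟨fun s => ∫ r in (0 : ℝ)..s, f r, fun s =>
      intervalIntegral.integral_hasDerivAt_right (hf.intervalIntegrable _ _)
        (hf.stronglyMeasurableAtFilter _ _) hf.continuousAt⟩
  have hFc : Continuous F := continuous_iff_continuousAt.2 fun s => (hF s).continuousAt
  obtain ⟨S, hS, hSA⟩ := hA.exists_contractionSemigroup
  set v : ℝ → H := fun s => Real.exp (F t₀ - F s) • d s with hv
  have hvi : ∀ t, t₀ ≤ t → IntervalIntegrable v volume t₀ t := fun t ht =>
    (hd.intervalIntegrable ht₀ ht).continuousOn_smul (by fun_prop)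
  set Y : ℝ → H := fun t => S (t - t₀) x₀ + ∫ s in t₀..t, S (t - s) (v s) with hY
  have hYc : ContinuousOn Y (Ici t₀) := hS.continuousOn_duhamel x₀ hvi
  have he : ∀ s, HasDerivAt (fun s => Real.exp (F s - F t₀))
      (f s * Real.exp (F s - F t₀)) s := fun s => by
    have := ((hF s).sub_const (F t₀)).exp
    rwa [mul_comm] at this
  have hcancel : ∀ s, Real.exp (F s - F t₀) • v s = d s := fun s => by
    rw [hv]
    simp only
    rw [smul_smul, ← Real.exp_add, sub_add_sub_cancel, sub_self, Real.exp_zero, one_smul]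
  have hXmild : IsMildSolution A f d t₀ x₀ fun t => Real.exp (F t - F t₀) • Y t := by
    refine ⟨S, hS, hSA, ?_, fun t ht => ?_⟩
    · exact ContinuousOn.smul (by fun_prop) hYc
    · have := hS.duhamel_smul (f := fun _ => 0) (x₀ := x₀) (X := Y) continuous_const hf he
        (by simp) hvi hYc (fun t _ => by simp [hY]) ht
      simpa only [zero_add, hcancel] using this
  refine ⟨_, hXmild, fun Z hZ t ht => ?_⟩
  obtain ⟨T, hT, hTA, hZeq⟩ := hZ.exists_variation_of_constants hf hF ht₀ hd
  have ht : t₀ ≤ t := ht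
  -- The semigroup `T` carried by `Z` need not be `S` a priori; the two agree at nonnegative times
  -- because they share a generator.
  have h1 : Real.exp (F t₀ - F t) • Z t = Y t := by
    rw [hZeq t ht, hY]
    simp only
    rw [hTA.apply_eq hA hT hS hSA (sub_nonneg.2 ht)]
    congr 1
    refine intervalIntegral.integral_congr fun s hs => ?_
    rw [uIcc_of_le ht] at hs
    rw [hTA.apply_eq hA hT hS hSA (sub_nonneg.2 hs.2)]
  rw [← h1, smul_smul, ← Real.exp_add, sub_add_sub_cancel, sub_self, Real.exp_zero, one_smul]

theorem IsMildSolution.norm_le (hX : IsMildSolution A f d t₀ x₀ X) (hf : Continuous f)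
    (hF : ∀ s, HasDerivAt F (f s) s) (ht₀ : 0 ≤ t₀) (hd : IsDisturbance d) {t : ℝ}
    (ht : t₀ ≤ t) :
    ‖X t‖ ≤ Real.exp (F t - F t₀) * ‖x₀‖ +
      supNorm d * ∫ s in t₀..t, Real.exp (F t - F s) := by
  have hFc : Continuous F := continuous_iff_continuousAt.2 fun s => (hF s).continuousAt
  obtain ⟨S, hS, -, h⟩ := hX.exists_variation_of_constants hf hF ht₀ hd
  have h1 : X t = Real.exp (F t - F t₀) • (S (t - t₀) x₀ +
      ∫ s in t₀..t, S (t - s) (Real.exp (F t₀ - F s) • d s)) := by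
    rw [← h t ht, smul_smul, ← Real.exp_add, sub_add_sub_cancel, sub_self, Real.exp_zero, one_smul]
  have h2 : ‖∫ s in t₀..t, S (t - s) (Real.exp (F t₀ - F s) • d s)‖ ≤
      ∫ s in t₀..t, supNorm d * Real.exp (F t₀ - F s) := by
    refine intervalIntegral.norm_integral_le_of_norm_le ht ?_
      (Continuous.intervalIntegrable (by fun_prop) _ _)
    filter_upwards [hd.ae_norm_le] with s hs hst
    refine (hS.contraction _ (sub_nonneg.2 hst.2) _).trans ?_
    rw [norm_smul, Real.norm_of_nonneg (Real.exp_pos _).le, mul_comm]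
    exact mul_le_mul_of_nonneg_right (hs (ht₀.trans hst.1.le)) (Real.exp_pos _).le
  have h3 : ∫ s in t₀..t, Real.exp (F t - F s) =
      Real.exp (F t - F t₀) * ∫ s in t₀..t, Real.exp (F t₀ - F s) := by
    rw [← intervalIntegral.integral_const_mul]
    refine intervalIntegral.integral_congr fun s _ => ?_
    rw [← Real.exp_add, sub_add_sub_cancel]
  rw [intervalIntegral.integral_const_mul] at h2
  rw [h1, norm_smul, Real.norm_of_nonneg (Real.exp_pos _).le, h3, mul_left_comm, ← mul_add]
  refine mul_le_mul_of_nonneg_left ?_ (Real.exp_pos _).le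
  exact (norm_add_le _ _).trans (add_le_add (hS.contraction _ (sub_nonneg.2 ht) _) h2)

end Mild

/-! ### Stability estimates for the closed loop -/

section Gain

theorem continuous_feedbackGain (K : ℝ) {n : ℝ} (hn : 0 ≤ n) : Continuous (feedbackGain K n) :=
  continuous_const.mul ((Real.continuous_rpow_const hn).comp (continuous_const.add continuous_id))

theorem feedbackGain_le {K n s : ℝ} (hK : 0 ≤ K) (hn : 1 ≤ n) (hs : 0 ≤ s) :
    feedbackGain K n s ≤ -(K * (1 + s)) := by
  have h1 : (1 : ℝ) ≤ 1 + s := by linarith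
  have h2 : 1 + s ≤ (1 + s) ^ n := by
    simpa using Real.rpow_le_rpow_of_exponent_le h1 hn
  rw [feedbackGain, psi]
  nlinarith

theorem hasDerivAt_mul_add_two_div_two (s : ℝ) :
    HasDerivAt (fun s : ℝ => s * (s + 2) / 2) (1 + s) s := by
  have := ((hasDerivAt_id' s).fun_mul ((hasDerivAt_id' s).add_const 2)).div_const 2
  refine this.congr_deriv ?_
  ring

theorem primitive_feedbackGain_sub_le {K n : ℝ} (hK : 0 ≤ K) (hn : 1 ≤ n) {F : ℝ → ℝ}
    (hF : ∀ s, HasDerivAt F (feedbackGain K n s) s) {s t : ℝ} (hs : 0 ≤ s) (hst : s ≤ t) :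
    F t - F s ≤ -(K * (t * (t + 2) / 2 - s * (s + 2) / 2)) := by
  have hd : ∀ s, HasDerivAt (fun s => F s + K * (s * (s + 2) / 2))
      (feedbackGain K n s + K * (1 + s)) s := fun s =>
    (hF s).add ((hasDerivAt_mul_add_two_div_two s).const_mul K)
  have hanti : AntitoneOn (fun s => F s + K * (s * (s + 2) / 2)) (Ici 0) := by
    refine antitoneOn_of_deriv_nonpos (convex_Ici 0)
      (fun s _ => (hd s).continuousAt.continuousWithinAt)
      (fun s _ => (hd s).differentiableAt.differentiableWithinAt) fun s hs => ?_
    rw [interior_Ici] at hs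
    rw [(hd s).deriv]
    linarith [feedbackGain_le hK hn (le_of_lt (mem_Ioi.1 hs))]
  have := hanti hs (hs.trans hst) hst
  simp only at this
  linarith

theorem integral_exp_neg_mul_sub_le {c : ℝ} (hc : 0 < c) (t₀ t : ℝ) :
    ∫ s in t₀..t, Real.exp (-(c * (t - s))) ≤ 1 / c := by
  have hd : ∀ s, HasDerivAt (fun s => Real.exp (-(c * (t - s))) / c)
      (Real.exp (-(c * (t - s)))) s := fun s => by
    have h := ((((hasDerivAt_id' s).const_sub t).const_mul c).fun_neg.exp).div_const c
    refine h.congr_deriv ?_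
    field_simp
  rw [intervalIntegral.integral_eq_sub_of_hasDerivAt (fun s _ => hd s)
    (Continuous.intervalIntegrable (by fun_prop) _ _)]
  simp only [sub_self, mul_zero, neg_zero, Real.exp_zero]
  have : 0 ≤ Real.exp (-(c * (t - t₀))) / c := by positivity
  linarith

/-- Only the middle summand of the constant is needed; the other two are nonnegative. -/
theorem add_one_le_rConst_one {a : ℝ} (ha : 0 < a) : a + 1 ≤ rConst a 1 := by
  have h1 : 0 ≤ ∫ s in (0 : ℝ)..max 0 ((a * 1 - 1) / a),
      Real.exp (s - (a * 1 - 1) / a) / (a * s + 1) ^ (1 : ℝ) := by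
    refine intervalIntegral.integral_nonneg (le_max_left _ _) fun s hs => ?_
    have hs : 0 ≤ s := hs.1
    positivity
  have h2 : 0 ≤ 1 - Real.exp (-(1 / a)) := by
    have : 0 < 1 / a := by positivity
    rw [sub_nonneg, Real.exp_le_one_iff]
    linarith
  rw [rConst]
  have h3 : 0 ≤ (a * 1) ^ (1 : ℝ) := by positivity
  have h4 : 0 ≤ ((a * 1 + 1) / (a * 1)) ^ (1 : ℝ) := by positivity
  have := mul_nonneg h3 h1
  have := mul_nonneg h4 h2
  linarith

theorem integral_exp_div_psi_mul_sq_le {η : ℝ} (hη : 0 < η) {t : ℝ} (ht : 0 ≤ t) :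
    (∫ s in (0 : ℝ)..t, Real.exp (-(η * (t * (t + 2) / 2 - s * (s + 2) / 2))) / psi s) *
      psi t ^ 2 ≤ 1 / η * (2 / η + 1) := by
  set D : ℝ → ℝ := fun s => t * (t + 2) / 2 - s * (s + 2) / 2 with hD
  have hDd : ∀ s, HasDerivAt D (-(1 + s)) s := fun s =>
    (hasDerivAt_mul_add_two_div_two s).const_sub _
  have hDc : Continuous D := by fun_prop
  have hpsi : ∀ s, 0 ≤ s → 0 < psi s := fun s hs => by rw [psi]; linarith
  have hpsic : Continuous psi := by unfold psi; fun_prop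
  -- An explicit primitive of the majorant below; the term 2/η² cancels the derivative of the factor
  -- 1 + 2D.
  have hd : ∀ s, HasDerivAt
      (fun s => Real.exp (-(η * D s)) * ((1 + 2 * D s) / η + 2 / η ^ 2))
      (psi s * Real.exp (-(η * D s)) * (1 + 2 * D s)) s := fun s => by
    have h1 := ((hDd s).const_mul η).fun_neg.exp
    have h2 := ((((hDd s).const_mul 2).const_add 1).div_const η).add_const (2 / η ^ 2)
    refine (h1.fun_mul h2).congr_deriv ?_
    rw [psi]
    field_simp
    ring
  -- Since ψ(t)² = ψ(s)² + 2D(s) and ψ(s) ≥ 1, one has ψ(t)² ≤ ψ(s)²(1 + 2D(s)), which absorbs the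
  -- denominator.
  have hle : ∫ s in (0 : ℝ)..t, Real.exp (-(η * D s)) / psi s * psi t ^ 2 ≤
      ∫ s in (0 : ℝ)..t, psi s * Real.exp (-(η * D s)) * (1 + 2 * D s) := by
    refine intervalIntegral.integral_mono_on ht ?_
      (Continuous.intervalIntegrable (by fun_prop) _ _) fun s hs => ?_
    · refine ContinuousOn.intervalIntegrable ?_
      rw [uIcc_of_le ht]
      exact (ContinuousOn.div (by fun_prop) hpsic.continuousOn
        fun s hs => (hpsi s hs.1).ne').mul continuousOn_const
    · have h1 : psi t ^ 2 = psi s ^ 2 + 2 * D s := by simp only [psi, hD]; ring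
      have h2 : 0 ≤ D s := by
        have : D s = (t - s) * (t + s + 2) / 2 := by simp only [hD]; ring
        rw [this]
        have := mul_nonneg (sub_nonneg.2 hs.2) (show 0 ≤ t + s + 2 by linarith [hs.1])
        linarith
      have h3 : 1 ≤ psi s := by rw [psi]; linarith [hs.1]
      rw [div_mul_eq_mul_div, div_le_iff₀ (hpsi s hs.1), h1]
      have h4 : psi s ^ 2 + 2 * D s ≤ psi s ^ 2 * (1 + 2 * D s) := by
        nlinarith [mul_nonneg (show 0 ≤ psi s ^ 2 - 1 by nlinarith) h2]
      nlinarith [mul_le_mul_of_nonneg_left h4 (Real.exp_pos (-(η * D s))).le]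
  rw [intervalIntegral.integral_mul_const, intervalIntegral.integral_eq_sub_of_hasDerivAt
    (fun s _ => hd s) (Continuous.intervalIntegrable (by fun_prop) _ _)] at hle
  have hDt : D t = 0 := by simp [hD]
  have hD0 : 0 ≤ D 0 := by simp only [hD]; nlinarith
  have h0 : 0 ≤ Real.exp (-(η * D 0)) * ((1 + 2 * D 0) / η + 2 / η ^ 2) := by positivity
  refine hle.trans ?_
  rw [hDt]
  simp only [mul_zero, neg_zero, Real.exp_zero, one_mul, add_zero]
  have : 1 / η + 2 / η ^ 2 = 1 / η * (2 / η + 1) := by field_simp; ring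
  linarith

/-- The quadratic form of the variation of constants estimate. -/
theorem sq_exp_mul_add_mul_integral_le {K : ℝ} {t : ℝ} (ht : 0 ≤ t) (x D : ℝ) :
    (Real.exp (-(K * (t * (t + 2) / 2))) * x +
        D * ∫ s in (0 : ℝ)..t, Real.exp (-(K * (t * (t + 2) / 2 - s * (s + 2) / 2)))) ^ 2 ≤
      Real.exp (-((2 * K - 1) * t * (t + 2) / 2)) * x ^ 2 +
        D ^ 2 * ∫ s in (0 : ℝ)..t,
          Real.exp (-((2 * K - 1) * (t * (t + 2) / 2 - s * (s + 2) / 2))) / psi s := by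
  set Δ : ℝ → ℝ := fun s => t * (t + 2) / 2 - s * (s + 2) / 2 with hΔ
  have hΔd : ∀ s, HasDerivAt Δ (-(1 + s)) s := fun s =>
    (hasDerivAt_mul_add_two_div_two s).const_sub _
  have hΔc : Continuous Δ := by fun_prop
  have hpsi : ∀ s, 0 ≤ s → 0 < psi s := fun s hs => by rw [psi]; linarith
  have hpsic : Continuous psi := by unfold psi; fun_prop
  set J := ∫ s in (0 : ℝ)..t, Real.exp (-(K * Δ s)) with hJ
  set I := ∫ s in (0 : ℝ)..t, Real.exp (-((2 * K - 1) * Δ s)) / psi s with hI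
  set φ := t * (t + 2) / 2 with hφ
  set Z := Real.exp (-(K * φ)) * x + D * J with hZ
  have hexp : ∫ s in (0 : ℝ)..t, Real.exp (-Δ s) * psi s = 1 - Real.exp (-φ) := by
    have hd : ∀ s, HasDerivAt (fun s => Real.exp (-Δ s)) (Real.exp (-Δ s) * psi s) s := fun s => by
      have := (hΔd s).neg.exp
      rwa [neg_neg] at this
    rw [intervalIntegral.integral_eq_sub_of_hasDerivAt (fun s _ => hd s)
      (Continuous.intervalIntegrable (by fun_prop) _ _)]
    simp [hΔ, hφ]
  have hIi : IntervalIntegrable (fun s => Real.exp (-((2 * K - 1) * Δ s)) / psi s) volume 0 t := by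
    refine ContinuousOn.intervalIntegrable ?_
    rw [uIcc_of_le ht]
    exact ContinuousOn.div (by fun_prop) hpsic.continuousOn fun s hs => (hpsi s hs.1).ne'
  have hEi : IntervalIntegrable (fun s => Real.exp (-Δ s) * psi s) volume 0 t :=
    Continuous.intervalIntegrable (by fun_prop) _ _
  -- Young's inequality under the integral, splitting e^{-KΔ} as e^{-(2K-1)Δ/2} e^{-Δ/2} with weight
  -- ψ. The Z² terms here and in `hx` have coefficients 1 - e^{-φ} and e^{-φ}, which add up to 1, so
  -- one of the two copies of Z² is absorbed.
  have hint : 2 * D * Z * J ≤ D ^ 2 * I + Z ^ 2 * (1 - Real.exp (-φ)) := by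
    rw [← hexp, hJ, hI, ← intervalIntegral.integral_const_mul, ← intervalIntegral.integral_const_mul,
      ← intervalIntegral.integral_const_mul, ← intervalIntegral.integral_add (hIi.const_mul _)
        (hEi.const_mul _)]
    refine intervalIntegral.integral_mono_on ht (Continuous.intervalIntegrable (by fun_prop) _ _)
      ((hIi.const_mul _).add (hEi.const_mul _)) fun s hs => ?_
    have hp := hpsi s hs.1
    set u := Real.exp (-((2 * K - 1) * Δ s) / 2) with hu
    set w := Real.exp (-Δ s / 2) with hw
    have e1 : Real.exp (-((2 * K - 1) * Δ s)) = u ^ 2 := by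
      rw [hu, ← Real.exp_nat_mul]; congr 1; push_cast; ring
    have e2 : Real.exp (-Δ s) = w ^ 2 := by
      rw [hw, ← Real.exp_nat_mul]; congr 1; push_cast; ring
    have e3 : Real.exp (-(K * Δ s)) = u * w := by
      rw [hu, hw, ← Real.exp_add]; congr 1; ring
    rw [e1, e2, e3]
    have : D ^ 2 * (u ^ 2 / psi s) + Z ^ 2 * (w ^ 2 * psi s) - 2 * D * Z * (u * w) =
        (D * u - Z * w * psi s) ^ 2 / psi s := by
      field_simp
      ring
    have h2 : 0 ≤ (D * u - Z * w * psi s) ^ 2 / psi s := by positivity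
    linarith
  have hx : 2 * Z * (Real.exp (-(K * φ)) * x) ≤
      Real.exp (-((2 * K - 1) * t * (t + 2) / 2)) * x ^ 2 + Z ^ 2 * Real.exp (-φ) := by
    set u := Real.exp (-((2 * K - 1) * φ) / 2) with hu
    set w := Real.exp (-φ / 2) with hw
    have e1 : Real.exp (-((2 * K - 1) * t * (t + 2) / 2)) = u ^ 2 := by
      rw [hu, ← Real.exp_nat_mul]; congr 1; push_cast; rw [hφ]; ring
    have e2 : Real.exp (-φ) = w ^ 2 := by
      rw [hw, ← Real.exp_nat_mul]; congr 1; push_cast; ring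
    have e3 : Real.exp (-(K * φ)) = u * w := by
      rw [hu, hw, ← Real.exp_add]; congr 1; ring
    rw [e1, e2, e3]
    nlinarith [sq_nonneg (u * x - Z * w)]
  have hZ2 : 2 * Z ^ 2 = 2 * Z * (Real.exp (-(K * φ)) * x) + 2 * D * Z * J := by
    rw [hZ]; ring
  linarith

end Gain

/-! ### ISS, hyperexponential and quadratic bounds -/

section Stability

variable {H : Type*} [NormedAddCommGroup H] [InnerProductSpace ℝ H] [CompleteSpace H]
  {A : H →ₗ.[ℝ] H} {K n : ℝ}

theorem IsMildSolution.norm_le_of_feedbackGain {d X : ℝ → H} {t₀ : ℝ} {x₀ : H}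
    (hX : IsMildSolution A (feedbackGain K n) d t₀ x₀ X) (hK : 0 ≤ K) (hn : 1 ≤ n)
    (ht₀ : 0 ≤ t₀) (hd : IsDisturbance d) {t : ℝ} (ht : t₀ ≤ t) :
    ‖X t‖ ≤ Real.exp (-(K * (t * (t + 2) / 2 - t₀ * (t₀ + 2) / 2))) * ‖x₀‖ +
      supNorm d * ∫ s in t₀..t, Real.exp (-(K * (t * (t + 2) / 2 - s * (s + 2) / 2))) := by
  have hf := continuous_feedbackGain K (zero_le_one.trans hn)
  obtain ⟨F, hF⟩ : ∃ F : ℝ → ℝ, ∀ s, HasDerivAt F (feedbackGain K n s) s :=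
    ⟨fun s => ∫ r in (0 : ℝ)..s, feedbackGain K n r, fun s =>
      intervalIntegral.integral_hasDerivAt_right (hf.intervalIntegrable _ _)
        (hf.stronglyMeasurableAtFilter _ _) hf.continuousAt⟩
  have hFc : Continuous F := continuous_iff_continuousAt.2 fun s => (hF s).continuousAt
  refine (hX.norm_le hf hF ht₀ hd ht).trans (add_le_add ?_ ?_)
  · exact mul_le_mul_of_nonneg_right
      (Real.exp_le_exp.2 (primitive_feedbackGain_sub_le hK hn hF ht₀ ht)) (norm_nonneg _)
  · refine mul_le_mul_of_nonneg_left ?_ (supNorm_nonneg d)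
    refine intervalIntegral.integral_mono_on ht (Continuous.intervalIntegrable (by fun_prop) _ _)
      (Continuous.intervalIntegrable (by fun_prop) _ _) fun s hs => ?_
    exact Real.exp_le_exp.2 (primitive_feedbackGain_sub_le hK hn hF (ht₀.trans hs.1) hs.2)

/-- Reduces the disturbance gain to a linear lower bound on the exponent; c may depend on t₀ and t,
which the hyperexponential estimate exploits. -/
theorem integral_exp_le_of_rate {K c t₀ t : ℝ} (hc : 0 < c) (ht : t₀ ≤ t)
    (h : ∀ s ∈ Icc t₀ t, c * (t - s) ≤ K * (t * (t + 2) / 2 - s * (s + 2) / 2)) :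
    ∫ s in t₀..t, Real.exp (-(K * (t * (t + 2) / 2 - s * (s + 2) / 2))) ≤ 1 / c := by
  refine le_trans ?_ (integral_exp_neg_mul_sub_le hc t₀ t)
  refine intervalIntegral.integral_mono_on ht (Continuous.intervalIntegrable (by fun_prop) _ _)
    (Continuous.intervalIntegrable (by fun_prop) _ _) fun s hs => ?_
  exact Real.exp_le_exp.2 (neg_le_neg (h s hs))

theorem isClassK_const_mul {c : ℝ} (hc : 0 < c) : IsClassK fun s => c * s :=
  ⟨by fun_prop, fun _ _ _ _ h => mul_lt_mul_of_pos_left h hc, mul_zero c⟩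

theorem isClassKInf_const_mul {c : ℝ} (hc : 0 < c) : IsClassKInf fun s => c * s :=
  ⟨isClassK_const_mul hc, tendsto_id.const_mul_atTop hc⟩

theorem isClassKL_mul {g : ℝ → ℝ} (hg : ContinuousOn g (Ici 0)) (hpos : ∀ t, 0 ≤ t → 0 < g t)
    (hanti : StrictAntiOn g (Ici 0)) (hlim : Tendsto g atTop (𝓝 0)) :
    IsClassKL fun s t => g t * s := by
  refine ⟨?_, fun t ht => isClassK_const_mul (hpos t ht), fun s hs => ⟨fun a ha b hb hab =>
    mul_lt_mul_of_pos_right (hanti ha hb hab) hs, ?_⟩⟩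
  · exact (hg.comp continuousOn_snd fun p hp => hp.2).mul continuousOn_fst
  · simpa using hlim.mul_const s

theorem isUniformlyISS_feedbackGain (hK : 0 < K) (hn : 1 ≤ n) :
    IsUniformlyISS A (feedbackGain K n) := by
  refine ⟨fun s t => Real.exp (-(K * t)) * s, fun s => 1 / K * s, isClassKL_mul (by fun_prop)
    (fun t _ => Real.exp_pos _) (fun a _ b _ hab => ?_) ?_, isClassKInf_const_mul (by positivity),
    fun t₀ x₀ d X ht₀ hd hX t ht => ?_⟩
  · exact Real.exp_lt_exp.2 (neg_lt_neg (mul_lt_mul_of_pos_left hab hK))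
  · exact Real.tendsto_exp_neg_atTop_nhds_zero.comp (tendsto_id.const_mul_atTop hK)
  -- The mean value (t + s + 2)/2 of ψ over [s, t] is at least 1.
  have hrate : ∀ s ∈ Icc t₀ t, K * (t - s) ≤ K * (t * (t + 2) / 2 - s * (s + 2) / 2) := by
    intro s hs
    refine mul_le_mul_of_nonneg_left ?_ hK.le
    nlinarith [mul_nonneg (sub_nonneg.2 hs.2) (show 0 ≤ t + s by linarith [hs.1])]
  refine (hX.norm_le_of_feedbackGain hK.le hn ht₀ hd ht).trans (add_le_add ?_ ?_)
  · exact mul_le_mul_of_nonneg_right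
      (Real.exp_le_exp.2 (neg_le_neg (hrate t₀ ⟨le_rfl, ht⟩))) (norm_nonneg _)
  · rw [mul_comm]
    exact mul_le_mul_of_nonneg_right (integral_exp_le_of_rate hK ht hrate) (supNorm_nonneg d)

theorem isUniformlyHyperexponentiallyStable_feedbackGain (hK : 0 < K) (hn : 1 ≤ n) :
    IsUniformlyHyperexponentiallyStable A (feedbackGain K n) := by
  refine ⟨0, fun s => 1 * s, fun s => K / 2 * s, fun s t => 1 / (K / 2 * (t + 1)) * s, le_rfl,
    isClassKInf_const_mul one_pos, isClassKInf_const_mul (by positivity),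
    isClassKL_mul (g := fun t => 1 / (K / 2 * (t + 1))) ?_ (fun t ht => by positivity)
      (fun a ha b hb hab => ?_) ?_,
    fun t₀ x₀ d X ht₀ hd hX t ht => ?_⟩
  · refine ContinuousOn.div (by fun_prop) (by fun_prop) fun t ht => ?_
    have ht : 0 ≤ t := ht
    positivity
  · have ha : 0 ≤ a := ha
    exact one_div_lt_one_div_of_lt (by positivity) (by gcongr)
  · simp only [one_div]
    exact tendsto_inv_atTop_zero.comp ((tendsto_atTop_add_const_right _ 1 tendsto_id).const_mul_atTop
      (by positivity))
  have hτ : 0 ≤ t - t₀ := sub_nonneg.2 ht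
  -- Here t + s + 2 ≥ t - t₀ + 1. The rate grows with elapsed time, giving a Gaussian bound in the
  -- initial state and a disturbance gain of order 1/(t - t₀ + 1).
  have hrate : ∀ s ∈ Icc t₀ t, K / 2 * (t - t₀ + 1) * (t - s) ≤
      K * (t * (t + 2) / 2 - s * (s + 2) / 2) := by
    intro s hs
    have h1 := mul_nonneg (sub_nonneg.2 hs.2) (show 0 ≤ t₀ + s + 1 by linarith [hs.1])
    nlinarith [mul_nonneg hK.le h1]
  refine (hX.norm_le_of_feedbackGain hK.le hn ht₀ hd ht).trans (add_le_add ?_ ?_)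
  · simp only [one_mul]
    refine mul_le_mul_of_nonneg_right (Real.exp_le_exp.2 ?_) (norm_nonneg _)
    nlinarith [hrate t₀ ⟨le_rfl, ht⟩, mul_nonneg hK.le hτ]
  · rw [mul_comm]
    exact mul_le_mul_of_nonneg_right (integral_exp_le_of_rate (by positivity) ht hrate)
      (supNorm_nonneg d)

theorem IsMildSolution.sq_norm_le_of_feedbackGain {d X : ℝ → H} {x₀ : H}
    (hX : IsMildSolution A (feedbackGain K n) d 0 x₀ X) (hK : 1 / 2 < K) (hn : 1 ≤ n)
    (hd : IsDisturbance d) {t : ℝ} (ht : 0 ≤ t) :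
    ‖X t‖ ^ 2 ≤ Real.exp (-((2 * K - 1) * t * (t + 2) / 2)) * ‖x₀‖ ^ 2 +
      4 / (2 * K - 1) * rConst (2 / (2 * K - 1)) 1 * supNorm d ^ 2 / psi t ^ 2 := by
  have hη : 0 < 2 * K - 1 := by linarith
  have h1 := hX.norm_le_of_feedbackGain (by linarith) hn le_rfl hd ht
  simp only [zero_mul, zero_div, sub_zero] at h1
  have h2 := (pow_le_pow_left₀ (norm_nonneg _) h1 2).trans
    (sq_exp_mul_add_mul_integral_le ht ‖x₀‖ (supNorm d))
  refine h2.trans (add_le_add le_rfl ?_)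
  have hψ : 0 < psi t := by rw [psi]; linarith
  rw [le_div_iff₀ (by positivity), mul_assoc]
  have h3 := integral_exp_div_psi_mul_sq_le hη ht
  have h4 := add_one_le_rConst_one (show 0 < 2 / (2 * K - 1) by positivity)
  -- The constant obtained, (1/η)(2/η + 1), is below the stated one with a factor 4 to spare.
  have h5 : 1 / (2 * K - 1) * (2 / (2 * K - 1) + 1) ≤
      4 / (2 * K - 1) * rConst (2 / (2 * K - 1)) 1 := by
    have h6 : 0 < 2 / (2 * K - 1) := by positivity
    exact mul_le_mul (by gcongr; norm_num) h4 (by positivity) (by positivity)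
  rw [mul_comm]
  exact mul_le_mul_of_nonneg_right (h3.trans h5) (sq_nonneg _)

end Stability
theorem theorem2 {H : Type*} [NormedAddCommGroup H] [InnerProductSpace ℝ H] [CompleteSpace H]
    (A : H →ₗ.[ℝ] H) (hA : IsMAccretive A) (K n : ℝ) (hK : 1 / 2 < K) (hn : 1 ≤ n) :
    IsWellPosed A (feedbackGain K n) ∧
    IsUniformlyISS A (feedbackGain K n) ∧
    IsUniformlyHyperexponentiallyStable A (feedbackGain K n) ∧
    ∀ (x₀ : H) (d X : ℝ → H), IsDisturbance d →
      IsMildSolution A (feedbackGain K n) d 0 x₀ X →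
      ∀ t, 0 ≤ t →
        ‖X t‖ ^ 2 ≤ Real.exp (-((2 * K - 1) * t * (t + 2) / 2)) * ‖x₀‖ ^ 2 +
          4 / (2 * K - 1) * rConst (2 / (2 * K - 1)) 1 * supNorm d ^ 2 / psi t ^ 2 := by
  exact ⟨isWellPosed_of_continuous hA (continuous_feedbackGain K (zero_le_one.trans hn)),
    isUniformlyISS_feedbackGain (by linarith) hn,
    isUniformlyHyperexponentiallyStable_feedbackGain (by linarith) hn,
    fun _ _ _ hd hX _ ht => hX.sq_norm_le_of_feedbackGain hK hn hd ht⟩
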